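/- **Setting.** Let $\{u_k(i)\}_{i\ge1}$ ($k=1,2$) and $\{v_j(i)\}_{i\ge1}$ ($j=1,2,3$) be five mutually independent sequences of i.i.d. strictly positive random variables with mean $1$ on a probability space $(\Omega,\mathcal F,\mathbb P)$; let $\sigma_k^2$ and $\varsigma_j^2$ be the variances of $u_k(1)$ and $v_j(1)$. For $n\in\mathbb N$ let $\lambda^n_k,\mu^n_j\in(0,\infty)$ with $\lambda^n_k\to\lambda_k\in(0,\infty)$, $\mu^n_j\to\mu_j\in(0,\infty)$. Assume $$\tfrac{\lambda_1}{\mu_1}+\tfrac{\lambda_2}{\mu_2}=1,\quad \tfrac{\lambda_2}{\mu_3}=1,\quad \sqrt n\Big(\tfrac{\lambda^n_i}{\mu^n_i}-\tfrac{\lambda_i}{\mu_i}\Big)\to b_i\in\mathbb R\ (i=1,2),\quad \sqrt n\Big(\tfrac{\lambda^n_2}{\mu^n_3}-1\Big)\to b_3\in\mathbb R,$$ and that $\mathbb E\,e^{l u_k(1)/\lambda_k}$ and $\mathbb E\,e^{l v_j(1)/\mu_j}$ are finite for all $l$ in some open neighbourhood of $0$. Let $A^n_k(t)=\sup\{l\ge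 0:\sum_{i=1}^l u_k(i)/\lambda^n_k\le t\}$ and $S^n_j(t)=\sup\{l\ge 0:\sum_{i=1}^l v_j(i)/\mu^n_j\le t\}$. If $T^n_j(t)$ is the cumulative service time given to Class $j$ in $[0,t]$, the queue lengths and workloads of the $n$-th (crisscross) network are $$Q^n_i=A^n_i-S^n_i(T^n_i)\ (i=1,2),\quad Q^n_3=S^n_2(T^n_2)-S^n_3(T^n_3),\quad W^n_1=\tfrac{Q^n_1}{\mu^n_1}+\tfrac{Q^n_2}{\mu^n_2},\quad W^n_2=\tfrac{Q^n_2+Q^n_3}{\mu^n_3},$$ and $\hat W^n(t)=n^{-1/2}W^n(nt)$. **Free boundary.** Let $\gamma>0$ be a discount factor and $h_1,h_2,h_3>0$ holding costs with $h_2\mu_2-h_3\mu_2<0$ and $h_2\mu_2-h_1\mu_1\ge0$. For $w\in\mathbb R_+^2$ let $\hat h(w)$ be the minimum of $h_1q_1+h_2q_2+h_3q_3$ over $q\ge0$ with $\frac{q_1}{\mu_1}+\frac{q_2}{\mu_2}=w_1$, $\frac{q_2+q_3}{\mu_3}=w_2$, that is, $\hat h(w)=h_1\mu_1w_1+\frac{\mu_3}{\mu_2}(h_2\mu_2-h_1\mu_1)w_2$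 if $\mu_3w_2\le\mu_2w_1$ and $\hat h(w)=(h_2\mu_2-h_3\mu_2)w_1+h_3\mu_3w_2$ otherwise. On some filtered probability space $(\Omega',\mathcal F',\{\mathcal F'_t\},\mathbb P')$ let $X$ be a three-dimensional $\{\mathcal F'_t\}$-Brownian motion with $X(0)=0$, drift $(\mu_1b_1,\mu_2b_2,\mu_3b_3-\mu_2b_2)$ and covariance matrix $$\begin{pmatrix}\sigma_1^2\lambda_1+\varsigma_1^2\lambda_1&0&0\\0&\sigma_2^2\lambda_2+\varsigma_2^2\lambda_2&-\varsigma_2^2\lambda_2\\0&-\varsigma_2^2\lambda_2&\varsigma_2^2\lambda_2+\varsigma_3^2\mu_3\end{pmatrix},$$ and put $B_1=\frac{X_1}{\mu_1}+\frac{X_2}{\mu_2}$, $B_2=\frac{X_2+X_3}{\mu_3}$. For $w\in\mathbb R^2_+$ let $J^*(w)=\inf_I\mathbb E'\int_0^\infty e^{-\gamma t}\hat h(w+B(t)+I(t))\,dt$, the infimum being over all $\{\mathcal F'_t\}$-adapted, right-continuous, componentwise nondecreasing $\mathbb R^2_+$-valued processes $I$ with $w+B(t)+I(t)\in\mathbb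 R^2_+$ for all $t\ge0$. Let $$\Psi(w_2)=\sup\{w_1\ge0:\partial_{w_1}J^*(w_1,w_2)=0\},\qquad w_2\ge0 .$$ **Policy.** For $c>1$, $l_0>1$, $g_0>0$ put $L^n=\lfloor l_0\log n\rfloor$ and $C^n=\lfloor c\,l_0\log n\rfloor$. Server 2 serves Class 3 whenever $Q^n_3>0$. Server 1 acts as follows, as a function of the current state. * If $Q^n_3-\frac{\mu^n_2}{\mu^n_1}Q^n_1<L^n$: serve Class 1 (if $Q_1^n>0$) when $Q^n_3\ge C^n-1$ or $Q^n_2=0$; serve Class 2 when $Q^n_3<C^n-1$ and $Q^n_2>0$. * If $Q^n_3-\frac{\mu^n_2}{\mu^n_1}Q^n_1\ge L^n$: serve Class 1 when $Q^n_1\ge\frac{\mu^n_1}{\mu^n_2}(C^n-L^n+2)$ or ($Q^n_2=0$ and $Q^n_1>0$); when $Q^n_1<\frac{\mu^n_1}{\mu^n_2}(C^n-L^n+2)$ and $Q^n_2>0$, serve Class 2 if $W^n_1-\sqrt n\,\Psi(W^n_2/\sqrt n)\ge g_0$ and idle otherwise. In all other cases the server idles. **Theorem.** For every $c>1$ there is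 $\bar l>1$, depending only on $c$ and on the data of the Setting, such that for all $l_0\ge\bar l$, all $g_0>0$ and all $h$, $\gamma$ as above the following holds. Let $T^n$ be, for all large $n$, the allocation process of the policy with parameters $c,l_0,g_0$. Then, for $i=1,2$, $$\limsup_{n\to\infty}\int_0^\infty e^{-\gamma t}\,\mathbb E\Big[\Big(\sup_{0\le s\le t}\hat W^n_i(s)\Big)^2\Big]dt<\infty$$ and $$\limsup_{T\to\infty}\ \limsup_{n\to\infty}\int_T^\infty e^{-\gamma t}\,\mathbb E\Big[\Big(\sup_{0\le s\le t}\hat W^n_i(s)\Big)^2\Big]dt=0 .$$ -/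

import Mathlib

open MeasureTheory ProbabilityTheory Filter Set
open scoped ENNReal NNReal Topology

noncomputable section

namespace Crisscross

/-! ### The queueing network

Classes `1, 2` and `1, 2, 3` are indexed by `Fin 2` and `Fin 3`, starting from `0`; the `i`-th
inter-arrival or service time, `i = 1, 2, …`, has index `i - 1 : ℕ`. -/

/-- Arrival rates of Classes 1, 2 and service rates of Classes 1, 2, 3. -/
structure Rates where
  lam : Fin 2 → ℝ
  mu : Fin 3 → ℝ

/-- The sequence of rates converges to positive limits, in heavy traffic. -/
structure HeavyTraffic (r : ℕ → Rates) (r' : Rates) (b : Fin 3 → ℝ) : Prop where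
  lam_pos : ∀ n k, 0 < (r n).lam k
  mu_pos : ∀ n j, 0 < (r n).mu j
  lam_lim_pos : ∀ k, 0 < r'.lam k
  mu_lim_pos : ∀ j, 0 < r'.mu j
  lam_tendsto : ∀ k, Tendsto (fun n => (r n).lam k) atTop (𝓝 (r'.lam k))
  mu_tendsto : ∀ j, Tendsto (fun n => (r n).mu j) atTop (𝓝 (r'.mu j))
  critical_one : r'.lam 0 / r'.mu 0 + r'.lam 1 / r'.mu 1 = 1
  critical_two : r'.lam 1 / r'.mu 2 = 1
  tendsto_one : Tendsto (fun n : ℕ => √(n : ℝ) *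
    ((r n).lam 0 / (r n).mu 0 - r'.lam 0 / r'.mu 0)) atTop (𝓝 (b 0))
  tendsto_two : Tendsto (fun n : ℕ => √(n : ℝ) *
    ((r n).lam 1 / (r n).mu 1 - r'.lam 1 / r'.mu 1)) atTop (𝓝 (b 1))
  tendsto_three : Tendsto (fun n : ℕ => √(n : ℝ) *
    ((r n).lam 1 / (r n).mu 2 - 1)) atTop (𝓝 (b 2))

/-- The unscaled inter-arrival times `u k i` and service times `v j i`: five mutually independent
sequences of i.i.d. positive random variables with mean one, whose moment generating functions are
finite near the origin. -/
structure PrimitiveTimes {Ω : Type*} [MeasurableSpace Ω] (P : Measure Ω) (r' : Rates)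
    (u : Fin 2 → ℕ → Ω → ℝ) (v : Fin 3 → ℕ → Ω → ℝ) : Prop where
  measurable_u : ∀ k i, Measurable (u k i)
  measurable_v : ∀ j i, Measurable (v j i)
  pos_u : ∀ k i, ∀ᵐ ω ∂P, 0 < u k i ω
  pos_v : ∀ j i, ∀ᵐ ω ∂P, 0 < v j i ω
  ident_u : ∀ k i, IdentDistrib (u k i) (u k 0) P P
  ident_v : ∀ j i, IdentDistrib (v j i) (v j 0) P P
  indep : iIndepFun (Sum.elim (fun p : Fin 2 × ℕ => u p.1 p.2)
    (fun p : Fin 3 × ℕ => v p.1 p.2)) P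
  mean_u : ∀ k, ∫ ω, u k 0 ω ∂P = 1
  mean_v : ∀ j, ∫ ω, v j 0 ω ∂P = 1
  mgf_finite : ∃ O : Set ℝ, IsOpen O ∧ (0 : ℝ) ∈ O ∧ ∀ l ∈ O,
    (∀ k, Integrable (fun ω => Real.exp (l * u k 0 ω / r'.lam k)) P) ∧
    (∀ j, Integrable (fun ω => Real.exp (l * v j 0 ω / r'.mu j)) P)

/-- The renewal counting function `sup {l ≥ 0 : x₁/ρ + ⋯ + x_l/ρ ≤ t}`. -/
def renewalCount (ρ : ℝ) (x : ℕ → ℝ) (t : ℝ) : ℕ :=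
  sSup {l : ℕ | ∑ i ∈ Finset.range l, x i / ρ ≤ t}

/-- Queue lengths at time `t` in the initially empty network with rates `ρ`, primitive times `x`
(arrivals) and `y` (services), when the allocation process is `T`, where `T t j` is the cumulative
service time given to Class `j` during `[0, t]`. -/
def queueLength (ρ : Rates) (x : Fin 2 → ℕ → ℝ) (y : Fin 3 → ℕ → ℝ) (T : ℝ → Fin 3 → ℝ)
    (t : ℝ) : Fin 3 → ℝ :=
  ![(renewalCount (ρ.lam 0) (x 0) t : ℝ) - renewalCount (ρ.mu 0) (y 0) (T t 0),
    (renewalCount (ρ.lam 1) (x 1) t : ℝ) - renewalCount (ρ.mu 1) (y 1) (T t 1),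
    (renewalCount (ρ.mu 1) (y 1) (T t 1) : ℝ) - renewalCount (ρ.mu 2) (y 2) (T t 2)]

/-- The workloads at the two stations, for the vector `q` of queue lengths. -/
def workload (ρ : Rates) (q : Fin 3 → ℝ) : Fin 2 → ℝ :=
  ![q 0 / ρ.mu 0 + q 1 / ρ.mu 1, q 1 / ρ.mu 2 + q 2 / ρ.mu 2]

/-! ### The workload control problem and its free boundary -/

/-- Drift of the limiting Brownian motion. -/
def limitDrift (r' : Rates) (b : Fin 3 → ℝ) : EuclideanSpace ℝ (Fin 3) :=
  !₂[r'.mu 0 * b 0, r'.mu 1 * b 1, r'.mu 2 * b 2 - r'.mu 1 * b 1]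

/-- Covariance matrix of the limiting Brownian motion, where `su k` and `sv j` are the variances of
the unscaled inter-arrival and service times. -/
def limitCov (r' : Rates) (su : Fin 2 → ℝ) (sv : Fin 3 → ℝ) : Matrix (Fin 3) (Fin 3) ℝ :=
  !![su 0 * r'.lam 0 + sv 0 * r'.lam 0, 0, 0;
    0, su 1 * r'.lam 1 + sv 1 * r'.lam 1, -(sv 1 * r'.lam 1);
    0, -(sv 1 * r'.lam 1), sv 1 * r'.lam 1 + sv 2 * r'.mu 2]

/-- `X` is a three-dimensional Brownian motion started at the origin, with respect to the
filtration `ℱ`, with drift vector `m` and covariance matrix `S`. -/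
structure IsBrownianMotion {Ω : Type*} {mΩ : MeasurableSpace Ω} (P : Measure Ω)
    (ℱ : Filtration ℝ≥0 mΩ) (m : EuclideanSpace ℝ (Fin 3)) (S : Matrix (Fin 3) (Fin 3) ℝ)
    (X : ℝ≥0 → Ω → EuclideanSpace ℝ (Fin 3)) : Prop where
  adapted : Adapted ℱ X
  start : ∀ ω, X 0 ω = 0
  continuous_paths : ∀ ω, Continuous (fun t => X t ω)
  indep_increments : ∀ s t, s ≤ t →
    Indep (MeasurableSpace.comap (fun ω => X t ω - X s ω) inferInstance) (ℱ s) P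
  law_increments : ∀ s t, s ≤ t →
    HasLaw (fun ω => X t ω - X s ω)
      (multivariateGaussian (((t : ℝ) - s) • m) (((t : ℝ) - s) • S)) P

/-- The Brownian motion `B = (X₁/μ₁ + X₂/μ₂, X₂/μ₃ + X₃/μ₃)` driving the workloads. -/
def workloadNoise (r' : Rates) (x : EuclideanSpace ℝ (Fin 3)) : Fin 2 → ℝ :=
  ![x 0 / r'.mu 0 + x 1 / r'.mu 1, x 1 / r'.mu 2 + x 2 / r'.mu 2]

/-- The effective cost rate: the minimum of `h₁ q₁ + h₂ q₂ + h₃ q₃` over all `q ≥ 0` with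
`q₁/μ₁ + q₂/μ₂ = w₁` and `q₂/μ₃ + q₃/μ₃ = w₂`, in closed form, for holding costs `h`. -/
def effectiveCost (r' : Rates) (h : Fin 3 → ℝ) (w : Fin 2 → ℝ) : ℝ :=
  if r'.mu 2 * w 1 ≤ r'.mu 1 * w 0 then
    h 0 * r'.mu 0 * w 0 + r'.mu 2 / r'.mu 1 * (h 1 * r'.mu 1 - h 0 * r'.mu 0) * w 1
  else
    (h 1 * r'.mu 1 - h 2 * r'.mu 1) * w 0 + h 2 * r'.mu 2 * w 1

/-- Workload started from `w`, under the control `I`. -/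
def controlledWorkload {Ω : Type*} (r' : Rates) (X : ℝ≥0 → Ω → EuclideanSpace ℝ (Fin 3))
    (w : Fin 2 → ℝ) (I : ℝ≥0 → Ω → Fin 2 → ℝ) (t : ℝ≥0) (ω : Ω) : Fin 2 → ℝ :=
  w + workloadNoise r' (X t ω) + I t ω

/-- `I` is an admissible control of the workload control problem for the initial condition `w`:
adapted, right continuous, nonnegative and nondecreasing (a jump at time `0` is allowed), keeping
both workloads nonnegative. -/
structure IsAdmissibleControl {Ω : Type*} {mΩ : MeasurableSpace Ω} (ℱ : Filtration ℝ≥0 mΩ)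
    (r' : Rates) (X : ℝ≥0 → Ω → EuclideanSpace ℝ (Fin 3)) (w : Fin 2 → ℝ)
    (I : ℝ≥0 → Ω → Fin 2 → ℝ) : Prop where
  adapted : Adapted ℱ I
  nonneg : ∀ t ω k, 0 ≤ I t ω k
  mono : ∀ ω, Monotone (fun t => I t ω)
  right_continuous : ∀ ω t, ContinuousWithinAt (fun s => I s ω) (Ici t) t
  workload_nonneg : ∀ t ω k, 0 ≤ controlledWorkload r' X w I t ω k

/-- Expected discounted cost of the control `I`. -/
def controlCost {Ω : Type*} {mΩ : MeasurableSpace Ω} (P : Measure Ω) (r' : Rates)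
    (h : Fin 3 → ℝ) (γ : ℝ) (X : ℝ≥0 → Ω → EuclideanSpace ℝ (Fin 3)) (w : Fin 2 → ℝ)
    (I : ℝ≥0 → Ω → Fin 2 → ℝ) : ℝ≥0∞ :=
  ∫⁻ ω, (∫⁻ t in Ici (0 : ℝ), ENNReal.ofReal (Real.exp (-γ * t) *
    effectiveCost r' h (controlledWorkload r' X w I t.toNNReal ω))) ∂P

/-- The optimal value function `J*` of the workload control problem. -/
def valueFunction {Ω : Type*} {mΩ : MeasurableSpace Ω} (P : Measure Ω) (ℱ : Filtration ℝ≥0 mΩ)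
    (r' : Rates) (h : Fin 3 → ℝ) (γ : ℝ) (X : ℝ≥0 → Ω → EuclideanSpace ℝ (Fin 3))
    (w : Fin 2 → ℝ) : ℝ :=
  (⨅ (I : ℝ≥0 → Ω → Fin 2 → ℝ) (_ : IsAdmissibleControl ℱ r' X w I),
    controlCost P r' h γ X w I).toReal

/-- The free boundary `Ψ(w₂) = sup {w₁ ≥ 0 : ∂J*/∂w₁ (w₁, w₂) = 0}`; the derivative is the
one-sided one at `w₁ = 0`. -/
def freeBoundary {Ω : Type*} {mΩ : MeasurableSpace Ω} (P : Measure Ω) (ℱ : Filtration ℝ≥0 mΩ)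
    (r' : Rates) (h : Fin 3 → ℝ) (γ : ℝ) (X : ℝ≥0 → Ω → EuclideanSpace ℝ (Fin 3))
    (w₂ : ℝ) : ℝ :=
  sSup {w₁ : ℝ | 0 ≤ w₁ ∧
    HasDerivWithinAt (fun x => valueFunction P ℱ r' h γ X ![x, w₂]) 0 (Ici 0) w₁}

/-! ### The control policy -/

/-- The threshold `⌊a log n⌋`. -/
def logThreshold (a : ℝ) (n : ℕ) : ℝ := (⌊a * Real.log n⌋ : ℤ)

/-- Server 1 serves Class 1 when the queue lengths are `q`; `ρ` are the rates of the `n`-th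
network, `L` and `C` its thresholds. -/
def ServesClassOne (ρ : Rates) (L C : ℝ) (q : Fin 3 → ℝ) : Prop :=
  (q 2 - ρ.mu 1 / ρ.mu 0 * q 0 < L ∧ 0 < q 0 ∧ (C - 1 ≤ q 2 ∨ q 1 = 0)) ∨
  (L ≤ q 2 - ρ.mu 1 / ρ.mu 0 * q 0 ∧
    (ρ.mu 0 / ρ.mu 1 * (C - L + 2) ≤ q 0 ∨ (q 1 = 0 ∧ 0 < q 0)))

/-- Server 1 serves Class 2 when the queue lengths are `q`. -/
def ServesClassTwo (ρ : Rates) (n : ℕ) (L C g₀ : ℝ) (Ψ : ℝ → ℝ) (q : Fin 3 → ℝ) : Prop :=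
  (q 2 - ρ.mu 1 / ρ.mu 0 * q 0 < L ∧ q 2 < C - 1 ∧ 0 < q 1) ∨
  (L ≤ q 2 - ρ.mu 1 / ρ.mu 0 * q 0 ∧ q 0 < ρ.mu 0 / ρ.mu 1 * (C - L + 2) ∧ 0 < q 1 ∧
    g₀ ≤ workload ρ q 0 - √(n : ℝ) * Ψ (workload ρ q 1 / √(n : ℝ)))

/-- `T` is a sample path of the allocation process of the policy with parameters `c, l₀, g₀` in the
`n`-th network, for the primitive times `x` and `y`: at every time, the classes in service are
those which the policy prescribes for the current queue lengths (Server 2 works whenever Buffer 3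
is nonempty), and each is served at full rate. -/
structure FollowsPolicy (ρ : Rates) (n : ℕ) (c l₀ g₀ : ℝ) (Ψ : ℝ → ℝ)
    (x : Fin 2 → ℕ → ℝ) (y : Fin 3 → ℕ → ℝ) (T : ℝ → Fin 3 → ℝ) : Prop where
  class_one : ∀ t, 0 ≤ t → T t 0 = (volume {s : ℝ | s ∈ Icc 0 t ∧
    ServesClassOne ρ (logThreshold l₀ n) (logThreshold (c * l₀) n)
      (queueLength ρ x y T s)}).toReal
  class_two : ∀ t, 0 ≤ t → T t 1 = (volume {s : ℝ | s ∈ Icc 0 t ∧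
    ServesClassTwo ρ n (logThreshold l₀ n) (logThreshold (c * l₀) n) g₀ Ψ
      (queueLength ρ x y T s)}).toReal
  class_three : ∀ t, 0 ≤ t → T t 2 = (volume {s : ℝ | s ∈ Icc 0 t ∧
    0 < queueLength ρ x y T s 2}).toReal

/-- The diffusion-scaled workload `n^{-1/2} W(n t)` of the `n`-th network. -/
def scaledWorkload (ρ : Rates) (n : ℕ) (x : Fin 2 → ℕ → ℝ) (y : Fin 3 → ℕ → ℝ)
    (T : ℝ → Fin 3 → ℝ) (t : ℝ) : Fin 2 → ℝ :=
  (√(n : ℝ))⁻¹ • workload ρ (queueLength ρ x y T (n * t))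

/-- `E[(sup_{0 ≤ s ≤ t} Z s)²]` for a nonnegative process `Z`. -/
def supSecondMoment {Ω : Type*} {mΩ : MeasurableSpace Ω} (P : Measure Ω) (Z : ℝ → Ω → ℝ)
    (t : ℝ) : ℝ≥0∞ :=
  ∫⁻ ω, (⨆ s ∈ Icc (0 : ℝ) t, ENNReal.ofReal (Z s ω)) ^ 2 ∂P

/-- `∫_{t₀}^∞ e^{-γ t} E[(sup_{0 ≤ s ≤ t} Z s)²] dt`. -/
def discountedTail {Ω : Type*} {mΩ : MeasurableSpace Ω} (P : Measure Ω) (γ : ℝ)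
    (Z : ℝ → Ω → ℝ) (t₀ : ℝ) : ℝ≥0∞ :=
  ∫⁻ t in Ici t₀, ENNReal.ofReal (Real.exp (-γ * t)) * supSecondMoment P Z t

end Crisscross

end

namespace Crisscross

/-! ### Renewal counting functions -/

/-! The policy keeps both stations nearly work conserving, whatever function `Ψ` it uses, so the
workloads stay comparable to the fluctuations of the primitive sequences.

Pathwise part. Heavy traffic forces `λ₂ < μ₂` and `μ₃ = λ₂ < μ₂`. While Buffer 3 holds fewer than
`L` customers, Class 2 has priority and fills Buffer 3 faster than Server 2 empties it. Hence Buffer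
3 can be empty only if Buffer 2 holds `O(κ)` customers, where `κ` is the error allowed for blocks of
partial sums (`queueLength_one_le_of_starving`). From the last time Buffer 3 was empty, Server 2
works without pause, so `Q₂ + Q₃` is bounded by `O(κ)` plus oscillations of the renewal processes
plus a drift of order `√n t` over `[0, nt]` (`queueLength_one_add_two_le`). Server 1 idles only when
`Q₁` is below a multiple of `C - L + 2`, because the test involving `Ψ` is reached only there; the
same last-time argument bounds `W₁` (`workload_zero_le`).

Probabilistic part. With `κ = K log n`, Chernoff bounds and a union over blocks show that the
required regularity fails with probability of order `N² n⁻⁴`, where `N` is of order `n(1 + t)`. On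
the failure event the workload is bounded by the number of arrivals, whose square is at most `N²`
plus a variable of finite mean that does not depend on the horizon (`slowSum`). On the regular event
Doob's `L²` inequality bounds the oscillations. After division by `n` the second moment of the
running maximum is at most `C (1 + t)⁴`, uniformly in large `n` (`exists_supSecondMoment_le`), and
discounting makes this integrable with vanishing tail. -/

/-- A sequence of positive numbers with divergent sum. -/
structure IsRenewalPath (x : ℕ → ℝ) : Prop where
  pos : ∀ i, 0 < x i
  unbounded : ∀ B : ℝ, ∃ m : ℕ, B < ∑ i ∈ Finset.range m, x i

namespace IsRenewalPath

variable {x : ℕ → ℝ} {ρ : ℝ}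

theorem sum_strictMono (hx : IsRenewalPath x) :
    StrictMono fun m => ∑ i ∈ Finset.range m, x i := by
  refine strictMono_nat_of_lt_succ fun m => ?_
  rw [Finset.sum_range_succ]
  linarith [hx.pos m]

/-- The supremum in `ℕ` is attained: divergence of the partial sums bounds the set (an unbounded one
would have the default supremum `0`), and `0 ≤ t` puts `0` in it. All later facts on counts go
through this Galois connection. -/
theorem le_renewalCount_iff (hx : IsRenewalPath x) (hρ : 0 < ρ) {t : ℝ} (ht : 0 ≤ t) (m : ℕ) :
    m ≤ renewalCount ρ x t ↔ ∑ i ∈ Finset.range m, x i ≤ ρ * t := by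
  have key : ∀ l : ℕ, ∑ i ∈ Finset.range l, x i / ρ ≤ t ↔ ∑ i ∈ Finset.range l, x i ≤ ρ * t := by
    intro l
    rw [← Finset.sum_div, div_le_iff₀' hρ]
  have hset : {l : ℕ | ∑ i ∈ Finset.range l, x i / ρ ≤ t} =
      {l : ℕ | ∑ i ∈ Finset.range l, x i ≤ ρ * t} := by
    ext l
    exact key l
  have hbdd : BddAbove {l : ℕ | ∑ i ∈ Finset.range l, x i ≤ ρ * t} := by
    obtain ⟨k, hk⟩ := hx.unbounded (ρ * t)
    refine ⟨k, fun l hl => ?_⟩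
    by_contra hlt
    push Not at hlt
    have := hx.sum_strictMono hlt
    simp only [mem_ofPred_eq] at hl this
    linarith
  have hne : {l : ℕ | ∑ i ∈ Finset.range l, x i ≤ ρ * t}.Nonempty :=
    ⟨0, by simp only [mem_ofPred_eq, Finset.range_zero, Finset.sum_empty]; positivity⟩
  unfold renewalCount
  rw [hset]
  constructor
  · intro h
    exact (hx.sum_strictMono.monotone h).trans (Nat.sSup_mem hne hbdd)
  · intro h
    exact le_csSup hbdd h

theorem sum_le (hx : IsRenewalPath x) (hρ : 0 < ρ) {t : ℝ} (ht : 0 ≤ t) :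
    ∑ i ∈ Finset.range (renewalCount ρ x t), x i ≤ ρ * t :=
  (hx.le_renewalCount_iff hρ ht _).1 le_rfl

theorem lt_sum (hx : IsRenewalPath x) (hρ : 0 < ρ) {t : ℝ} (ht : 0 ≤ t) {m : ℕ}
    (hm : renewalCount ρ x t < m) : ρ * t < ∑ i ∈ Finset.range m, x i := by
  by_contra h
  exact absurd ((hx.le_renewalCount_iff hρ ht m).2 (not_lt.1 h)) (not_le.2 hm)

theorem renewalCount_zero (hx : IsRenewalPath x) (hρ : 0 < ρ) : renewalCount ρ x 0 = 0 := by
  by_contra h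
  have h1 := (hx.le_renewalCount_iff hρ le_rfl 1).1 (Nat.one_le_iff_ne_zero.2 h)
  simp only [Finset.range_one, Finset.sum_singleton, mul_zero] at h1
  linarith [hx.pos 0]

theorem renewalCount_mono (hx : IsRenewalPath x) (hρ : 0 < ρ) {s t : ℝ} (hs : 0 ≤ s)
    (hst : s ≤ t) : renewalCount ρ x s ≤ renewalCount ρ x t :=
  (hx.le_renewalCount_iff hρ (hs.trans hst) _).2
    ((hx.sum_le hρ hs).trans (mul_le_mul_of_nonneg_left hst hρ.le))

end IsRenewalPath

/-- The centred partial sums over blocks inside `[0, N]` are small. -/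
def BlockRegular (x : ℕ → ℝ) (ε κ : ℝ) (N : ℕ) : Prop :=
  ∀ l m : ℕ, l ≤ m → m ≤ N → |∑ i ∈ Finset.Ico l m, (x i - 1)| ≤ ε * ((m : ℝ) - l) + κ

/-- The increments of a counting function on `[0, H]` are close to those of `t ↦ ρ t`. -/
def CountRegular (R : ℝ → ℕ) (ρ ε κ H : ℝ) : Prop :=
  ∀ s t, 0 ≤ s → s ≤ t → t ≤ H →
    (R t : ℝ) - R s ≤ (1 + ε) * ρ * (t - s) + κ ∧ (1 - ε) * ρ * (t - s) - κ ≤ (R t : ℝ) - R s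

/-- A counting function is within `M` of `t ↦ ρ t` on `[0, H]`. -/
def CountNear (R : ℝ → ℕ) (ρ M H : ℝ) : Prop :=
  ∀ s, 0 ≤ s → s ≤ H → |(R s : ℝ) - ρ * s| ≤ M

theorem CountNear.increment {R : ℝ → ℕ} {ρ M H s t : ℝ} (h : CountNear R ρ M H) (hs : 0 ≤ s)
    (hst : s ≤ t) (ht : t ≤ H) : |((R t : ℝ) - R s) - ρ * (t - s)| ≤ 2 * M := by
  have h1 := abs_le.1 (h s hs (hst.trans ht))
  have h2 := abs_le.1 (h t (hs.trans hst) ht)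
  rw [abs_le]
  constructor <;> linarith [h1.1, h1.2, h2.1, h2.2]

theorem sum_Ico_sub_one (x : ℕ → ℝ) {l m : ℕ} (hlm : l ≤ m) :
    ∑ i ∈ Finset.Ico l m, (x i - 1) =
      ∑ i ∈ Finset.range m, x i - ∑ i ∈ Finset.range l, x i - ((m : ℝ) - l) := by
  rw [Finset.sum_sub_distrib, Finset.sum_Ico_eq_sub _ hlm]
  simp [Nat.cast_sub hlm]

/-! ### From partial sums to counting functions. -/

namespace BlockRegular

variable {x : ℕ → ℝ} {ρ ε κ H : ℝ} {N : ℕ}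

/-- The first `N` terms sum to at least `N / 2 - κ > ρ H`. This keeps every index met up to time `H`
inside the range where block regularity is known. -/
theorem renewalCount_lt (h : BlockRegular x ε κ N) (hx : IsRenewalPath x) (hρ : 0 < ρ)
    (hH : 0 ≤ H) (hε : ε ≤ 1 / 2) (hN : 2 * (ρ * H + κ) < N) : renewalCount ρ x H < N := by
  by_contra hlt
  have h1 := (hx.le_renewalCount_iff hρ hH N).1 (not_lt.1 hlt)
  have h2 := (abs_le.1 (h 0 N (Nat.zero_le _) le_rfl)).1
  rw [sum_Ico_sub_one x (Nat.zero_le _)] at h2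
  simp only [Finset.range_zero, Finset.sum_empty, Nat.cast_zero, sub_zero] at h2
  have : (0 : ℝ) ≤ N := Nat.cast_nonneg _
  nlinarith

theorem countRegular (h : BlockRegular x ε κ N) (hx : IsRenewalPath x) (hρ : 0 < ρ)
    (hH : 0 ≤ H) (hε0 : 0 < ε) (hε : ε ≤ 1 / 2) (hκ : 0 ≤ κ) (hN : 2 * (ρ * H + κ) < N) :
    CountRegular (renewalCount ρ x) ρ (2 * ε) (2 * κ + 1) H := by
  intro s t hs hst htH
  have hlt := h.renewalCount_lt hx hρ hH hε hN
  have ht := hs.trans hst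
  set m := renewalCount ρ x t with hm
  set l := renewalCount ρ x s with hl
  have hlm : l ≤ m := hx.renewalCount_mono hρ hs hst
  have hmN : m < N := (hx.renewalCount_mono hρ ht htH).trans_lt hlt
  have hlm' : (l : ℝ) ≤ m := by exact_mod_cast hlm
  have hΔ : 0 ≤ ρ * (t - s) := mul_nonneg hρ.le (by linarith)
  constructor
  · rcases hlm.eq_or_lt with heq | hlt'
    · rw [heq, sub_self]
      have : 0 ≤ (1 + 2 * ε) * ρ * (t - s) := by
        rw [mul_assoc]; positivity
      linarith
    -- The block `[l + 1, m)` lies strictly inside the window, so its sum is below `ρ (t - s)`; the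
    -- omitted term accounts for the `+ 1` in the error.
    · have h1 := (abs_le.1 (h (l + 1) m hlt' hmN.le)).1
      rw [sum_Ico_sub_one x hlt'] at h1
      have h2 := hx.sum_le hρ ht
      have h3 := hx.lt_sum hρ hs (Nat.lt_succ_self l)
      rw [← hm] at h2
      push_cast at h1
      have h4 : ((m : ℝ) - l - 1) * (1 - ε) ≤ ρ * (t - s) + κ := by
        simp only [Nat.succ_eq_add_one] at h3
        nlinarith
      have h5 : ((m : ℝ) - l - 1) * ((1 - ε) * (1 + 2 * ε)) ≤
          (ρ * (t - s) + κ) * (1 + 2 * ε) := by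
        rw [← mul_assoc]
        exact mul_le_mul_of_nonneg_right h4 (by linarith)
      have h6 : (0 : ℝ) ≤ (m : ℝ) - l - 1 := by
        have : ((l + 1 : ℕ) : ℝ) ≤ m := by exact_mod_cast hlt'
        push_cast at this
        linarith
      -- Inverting the slope `1 - ε` is what doubles `ε`; this is where `ε ≤ 1 / 2` is needed.
      have h7 : 1 ≤ (1 - ε) * (1 + 2 * ε) := by nlinarith
      have h8 : (m : ℝ) - l - 1 ≤ ((m : ℝ) - l - 1) * ((1 - ε) * (1 + 2 * ε)) :=
        le_mul_of_one_le_right h6 h7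
      nlinarith
  -- For the lower bound the block is enlarged to `[l, m + 1)`, whose sum exceeds `ρ (t - s)`.
  · have h1 := (abs_le.1 (h l (m + 1) (by omega) (by omega))).2
    rw [sum_Ico_sub_one x (by omega)] at h1
    have h2 := hx.sum_le hρ hs
    have h3 := hx.lt_sum hρ ht (Nat.lt_succ_self m)
    rw [← hl] at h2
    push_cast at h1
    have h4 : ρ * (t - s) ≤ ((m : ℝ) - l + 1) * (1 + ε) + κ := by
      simp only [Nat.succ_eq_add_one] at h3
      nlinarith
    have h5 : (1 - ε) * (ρ * (t - s)) ≤ (1 - ε) * (((m : ℝ) - l + 1) * (1 + ε) + κ) :=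
      mul_le_mul_of_nonneg_left h4 (by linarith)
    have h6 : (0 : ℝ) ≤ (m : ℝ) - l := by linarith
    nlinarith [mul_nonneg hε0.le hΔ, mul_nonneg hε0.le hκ, mul_nonneg h6 (mul_nonneg hε0.le hε0.le)]

end BlockRegular

/-- With `m` the count at time `s`, the number `ρ s` lies between the partial sums of lengths `m`
and `m + 1`, each within `M` of its length. -/
theorem IsRenewalPath.countNear {x : ℕ → ℝ} {ρ H M : ℝ} {N : ℕ} (hx : IsRenewalPath x)
    (hρ : 0 < ρ) (hN : renewalCount ρ x H < N)
    (hM : ∀ m ≤ N, |∑ i ∈ Finset.range m, (x i - 1)| ≤ M) :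
    CountNear (renewalCount ρ x) ρ (M + 1) H := by
  intro s hs hsH
  have hlt := (hx.renewalCount_mono hρ hs hsH).trans_lt hN
  have key : ∀ m : ℕ, ∑ i ∈ Finset.range m, (x i - 1) = ∑ i ∈ Finset.range m, x i - m := by
    intro m
    simp
  have h1 := abs_le.1 (hM (renewalCount ρ x s) hlt.le)
  have h2 := abs_le.1 (hM (renewalCount ρ x s + 1) hlt)
  rw [key] at h1 h2
  have h3 := hx.sum_le hρ hs
  have h4 := hx.lt_sum hρ hs (Nat.lt_succ_self _)
  simp only [Nat.succ_eq_add_one] at h4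
  push_cast at h2
  rw [abs_le]
  constructor <;> linarith [h1.1, h1.2, h2.1, h2.2]

/-! ### Cumulative time spent in a set of states -/

/-- Lebesgue outer measure of the set of times in `[0, t]` at which `p` holds. -/
noncomputable def occupationTime (p : ℝ → Prop) (t : ℝ) : ℝ :=
  (volume {s : ℝ | s ∈ Icc 0 t ∧ p s}).toReal

section occupationTime

variable {p q : ℝ → Prop} {s t : ℝ}

theorem volume_occupation_ne_top (p : ℝ → Prop) (t : ℝ) :
    volume {s : ℝ | s ∈ Icc 0 t ∧ p s} ≠ ⊤ :=
  ne_top_of_le_ne_top (by simp : volume (Icc (0 : ℝ) t) ≠ ⊤) (measure_mono fun _ h => h.1)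

theorem occupationTime_nonneg (p : ℝ → Prop) (t : ℝ) : 0 ≤ occupationTime p t :=
  ENNReal.toReal_nonneg

theorem occupationTime_zero (p : ℝ → Prop) : occupationTime p 0 = 0 := by
  have : volume {s : ℝ | s ∈ Icc (0 : ℝ) 0 ∧ p s} = 0 :=
    measure_mono_null (fun s hs => hs.1) (by simp : volume (Icc (0 : ℝ) 0) = 0)
  rw [occupationTime, this, ENNReal.toReal_zero]

theorem occupationTime_mono (p : ℝ → Prop) (hst : s ≤ t) :
    occupationTime p s ≤ occupationTime p t :=
  ENNReal.toReal_mono (volume_occupation_ne_top p t)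
    (measure_mono fun _ h => ⟨⟨h.1.1, h.1.2.trans hst⟩, h.2⟩)

/-- The half-line is Carathéodory measurable, so it splits the outer measure of any set; `p` need
not define a measurable set. -/
theorem occupationTime_eq_add (p : ℝ → Prop) (hs : 0 ≤ s) (hst : s ≤ t) :
    occupationTime p t = occupationTime p s + (volume {r : ℝ | r ∈ Ioc s t ∧ p r}).toReal := by
  have h := measure_inter_add_sdiff (μ := volume) {r : ℝ | r ∈ Icc 0 t ∧ p r}
    (measurableSet_Iic (a := s))
  have h1 : {r : ℝ | r ∈ Icc 0 t ∧ p r} ∩ Iic s = {r : ℝ | r ∈ Icc 0 s ∧ p r} := by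
    ext r
    simp only [mem_inter_iff, mem_ofPred_eq, mem_Icc, mem_Iic]
    constructor
    · rintro ⟨⟨⟨h1, h2⟩, h3⟩, h4⟩
      exact ⟨⟨h1, h4⟩, h3⟩
    · rintro ⟨⟨h1, h2⟩, h3⟩
      exact ⟨⟨⟨h1, h2.trans hst⟩, h3⟩, h2⟩
  have h2 : {r : ℝ | r ∈ Icc 0 t ∧ p r} \ Iic s = {r : ℝ | r ∈ Ioc s t ∧ p r} := by
    ext r
    simp only [Set.mem_sdiff, mem_ofPred_eq, mem_Icc, mem_Iic, mem_Ioc, not_le]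
    constructor
    · rintro ⟨⟨⟨h1, h2⟩, h3⟩, h4⟩
      exact ⟨⟨h4, h2⟩, h3⟩
    · rintro ⟨⟨h1, h2⟩, h3⟩
      exact ⟨⟨⟨hs.trans h1.le, h2⟩, h3⟩, h1⟩
  rw [h1, h2] at h
  rw [occupationTime, ← h, ENNReal.toReal_add (volume_occupation_ne_top p s), occupationTime]
  exact ne_top_of_le_ne_top (by simp : volume (Ioc s t) ≠ ⊤) (measure_mono fun _ h => h.1)

theorem occupationTime_sub_le (p : ℝ → Prop) (hs : 0 ≤ s) (hst : s ≤ t) :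
    occupationTime p t - occupationTime p s ≤ t - s := by
  rw [occupationTime_eq_add p hs hst, add_sub_cancel_left]
  have h1 : volume {r : ℝ | r ∈ Ioc s t ∧ p r} ≤ volume (Ioc s t) := measure_mono fun _ h => h.1
  rw [Real.volume_Ioc] at h1
  exact ENNReal.toReal_le_of_le_ofReal (by linarith) h1

theorem occupationTime_le (p : ℝ → Prop) (ht : 0 ≤ t) : occupationTime p t ≤ t := by
  have := occupationTime_sub_le p le_rfl ht
  rw [occupationTime_zero] at this
  linarith

/-- Subadditivity of outer measure suffices. The gap between `s` and `r` accommodates a last time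
that is only approximated. -/
theorem le_occupationTime_add_sub {r : ℝ} (hs : 0 ≤ s) (hsr : s ≤ r) (hrt : r ≤ t)
    (h : ∀ a, r < a → a ≤ t → p a ∨ q a) :
    t - r ≤ (occupationTime p t - occupationTime p s) +
      (occupationTime q t - occupationTime q s) := by
  have hp := occupationTime_mono p hsr
  have hq := occupationTime_mono q hsr
  rw [occupationTime_eq_add p (hs.trans hsr) hrt, occupationTime_eq_add q (hs.trans hsr) hrt]
  have hfin : ∀ p : ℝ → Prop, volume {a : ℝ | a ∈ Ioc r t ∧ p a} ≠ ⊤ := fun p =>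
    ne_top_of_le_ne_top (by simp : volume (Ioc r t) ≠ ⊤) (measure_mono fun _ h => h.1)
  have h1 : volume (Ioc r t) ≤
      volume {a : ℝ | a ∈ Ioc r t ∧ p a} + volume {a : ℝ | a ∈ Ioc r t ∧ q a} := by
    refine (measure_mono fun a ha => ?_).trans (measure_union_le _ _)
    rcases h a ha.1 ha.2 with h' | h'
    · exact Or.inl ⟨ha, h'⟩
    · exact Or.inr ⟨ha, h'⟩
  have h2 := ENNReal.toReal_mono (ENNReal.add_ne_top.2 ⟨hfin p, hfin q⟩) h1
  rw [ENNReal.toReal_add (hfin p) (hfin q), Real.volume_Ioc,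
    ENNReal.toReal_ofReal (by linarith)] at h2
  linarith

theorem le_occupationTime_sub {r : ℝ} (hs : 0 ≤ s) (hsr : s ≤ r) (hrt : r ≤ t)
    (h : ∀ a, r < a → a ≤ t → p a) :
    t - r ≤ occupationTime p t - occupationTime p s := by
  have h1 := le_occupationTime_add_sub (p := p) (q := fun _ => False) hs hsr hrt
    fun a ha hat => Or.inl (h a ha hat)
  simpa [occupationTime] using h1

theorem continuousOn_occupationTime (p : ℝ → Prop) : ContinuousOn (occupationTime p) (Ici 0) := by
  refine LipschitzOnWith.continuousOn (K := 1) (LipschitzOnWith.of_le_add fun a ha b hb => ?_)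
  rcases le_total a b with hab | hab
  · exact (occupationTime_mono p hab).trans (le_add_of_nonneg_right dist_nonneg)
  · have := occupationTime_sub_le p hb hab
    rw [Real.dist_eq, abs_of_nonneg (by linarith)]
    linarith

/-- Time is spent in `p` only until the level `a` is reached. -/
theorem occupationTime_le_of_forall {a : ℝ} (ha : 0 ≤ a) (ht : 0 ≤ t)
    (h : ∀ s, 0 ≤ s → s ≤ t → p s → occupationTime p s < a) : occupationTime p t ≤ a := by
  by_contra hlt
  push Not at hlt
  obtain ⟨τ, hτ, hτa⟩ := intermediate_value_Icc ht
    ((continuousOn_occupationTime p).mono Icc_subset_Ici_self)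
    ⟨by rw [occupationTime_zero]; exact ha, hlt.le⟩
  -- Once the clock has reached `a`, at `τ`, the predicate can no longer hold, so the clock has
  -- stopped.
  have hle : occupationTime p t ≤ occupationTime p τ := by
    refine ENNReal.toReal_mono (volume_occupation_ne_top p τ) (measure_mono fun s hs => ?_)
    refine ⟨⟨hs.1.1, ?_⟩, hs.2⟩
    by_contra hs'
    have h1 := h s hs.1.1 hs.1.2 hs.2
    have h2 := occupationTime_mono p (not_le.1 hs').le
    linarith
  linarith

/-- A server that works only when customers are present serves no more of them than have
arrived. -/
theorem renewalCount_occupationTime_le {y : ℕ → ℝ} {ρ : ℝ} {R : ℝ → ℕ} (hy : IsRenewalPath y)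
    (hρ : 0 < ρ) (hR : ∀ s t, 0 ≤ s → s ≤ t → R s ≤ R t)
    (hp : ∀ s, 0 ≤ s → p s → renewalCount ρ y (occupationTime p s) < R s) (ht : 0 ≤ t) :
    renewalCount ρ y (occupationTime p t) ≤ R t := by
  by_contra hlt
  push Not at hlt
  have h1 := (hy.le_renewalCount_iff hρ (occupationTime_nonneg p t) (R t + 1)).1 hlt
  -- Work is done only while fewer than `R t` services are complete, so the clock cannot pass the
  -- total duration of the first `R t` services; one more completion would need strictly more.
  have h2 : occupationTime p t ≤ (∑ i ∈ Finset.range (R t), y i) / ρ := by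
    refine occupationTime_le_of_forall (div_nonneg (Finset.sum_nonneg fun i _ => (hy.pos i).le)
      hρ.le) ht fun s hs hst hps => ?_
    rw [lt_div_iff₀' hρ]
    exact hy.lt_sum hρ (occupationTime_nonneg p s) ((hp s hs hps).trans_le (hR s t hs hst))
  rw [le_div_iff₀' hρ] at h2
  have h3 := hy.sum_strictMono (Nat.lt_succ_self (R t))
  simp only [Nat.succ_eq_add_one] at h3
  linarith

end occupationTime

/-- The last time before `t`, up to `η`, at which `p` holds. -/
theorem exists_near_last_time {p : ℝ → Prop} {t η : ℝ} (hp : p 0) (ht : 0 ≤ t) (hη : 0 < η) :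
    ∃ s r, 0 ≤ s ∧ s ≤ r ∧ r ≤ t ∧ r ≤ s + η ∧ p s ∧ ∀ a, r < a → a ≤ t → ¬ p a := by
  set D := {s : ℝ | 0 ≤ s ∧ s ≤ t ∧ p s} with hD
  have hne : D.Nonempty := ⟨0, le_rfl, ht, hp⟩
  have hbdd : BddAbove D := ⟨t, fun s hs => hs.2.1⟩
  -- The supremum itself need not satisfy `p`, hence a time `s` with `p s` within `η` below it.
  obtain ⟨s, hs, hlt⟩ := exists_lt_of_lt_csSup hne (sub_lt_self (sSup D) hη)
  refine ⟨s, sSup D, hs.1, le_csSup hbdd hs, csSup_le hne fun s hs => hs.2.1, by linarith, hs.2.2,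
    fun a ha hat hpa => ?_⟩
  have : a ≤ sSup D := le_csSup hbdd ⟨hs.1.trans ((le_csSup hbdd hs).trans ha.le), hat, hpa⟩
  linarith

end Crisscross

namespace Crisscross

/-! ### Pathwise analysis of the policy -/

/-- Positive rates. -/
structure Rates.Positive (ρ : Rates) : Prop where
  lam : ∀ k, 0 < ρ.lam k
  mu : ∀ j, 0 < ρ.mu j

section Path

variable {ρ : Rates} {n : ℕ} {c l₀ g₀ : ℝ} {Ψ : ℝ → ℝ} {x : Fin 2 → ℕ → ℝ} {y : Fin 3 → ℕ → ℝ}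
  {T : ℝ → Fin 3 → ℝ}

theorem queueLength_apply_zero (ρ : Rates) (x : Fin 2 → ℕ → ℝ) (y : Fin 3 → ℕ → ℝ)
    (T : ℝ → Fin 3 → ℝ) (t : ℝ) : queueLength ρ x y T t 0 =
      (renewalCount (ρ.lam 0) (x 0) t : ℝ) - renewalCount (ρ.mu 0) (y 0) (T t 0) := rfl

theorem queueLength_apply_one (ρ : Rates) (x : Fin 2 → ℕ → ℝ) (y : Fin 3 → ℕ → ℝ)
    (T : ℝ → Fin 3 → ℝ) (t : ℝ) : queueLength ρ x y T t 1 =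
      (renewalCount (ρ.lam 1) (x 1) t : ℝ) - renewalCount (ρ.mu 1) (y 1) (T t 1) := rfl

theorem queueLength_apply_two (ρ : Rates) (x : Fin 2 → ℕ → ℝ) (y : Fin 3 → ℕ → ℝ)
    (T : ℝ → Fin 3 → ℝ) (t : ℝ) : queueLength ρ x y T t 2 =
      (renewalCount (ρ.mu 1) (y 1) (T t 1) : ℝ) - renewalCount (ρ.mu 2) (y 2) (T t 2) := rfl

/-- The three classes are served at the times given by predicates of the state. -/
structure IsAllocation (T : ℝ → Fin 3 → ℝ) (p : Fin 3 → ℝ → Prop) : Prop where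
  eq : ∀ t, 0 ≤ t → ∀ j, T t j = occupationTime (p j) t

theorem FollowsPolicy.isAllocation (hF : FollowsPolicy ρ n c l₀ g₀ Ψ x y T) :
    IsAllocation T ![
      fun s => ServesClassOne ρ (logThreshold l₀ n) (logThreshold (c * l₀) n)
        (queueLength ρ x y T s),
      fun s => ServesClassTwo ρ n (logThreshold l₀ n) (logThreshold (c * l₀) n) g₀ Ψ
        (queueLength ρ x y T s),
      fun s => 0 < queueLength ρ x y T s 2] := by
  refine ⟨fun t ht j => ?_⟩
  fin_cases j
  · exact hF.class_one t ht
  · exact hF.class_two t ht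
  · exact hF.class_three t ht

namespace IsAllocation

variable {p : Fin 3 → ℝ → Prop} {s t : ℝ}

theorem zero (hT : IsAllocation T p) (j : Fin 3) : T 0 j = 0 := by
  rw [hT.eq 0 le_rfl, occupationTime_zero]

theorem nonneg (hT : IsAllocation T p) (ht : 0 ≤ t) (j : Fin 3) : 0 ≤ T t j := by
  rw [hT.eq t ht]
  exact occupationTime_nonneg _ _

theorem mono (hT : IsAllocation T p) (hs : 0 ≤ s) (hst : s ≤ t) (j : Fin 3) : T s j ≤ T t j := by
  rw [hT.eq s hs, hT.eq t (hs.trans hst)]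
  exact occupationTime_mono _ hst

theorem le_self (hT : IsAllocation T p) (ht : 0 ≤ t) (j : Fin 3) : T t j ≤ t := by
  rw [hT.eq t ht]
  exact occupationTime_le _ ht

theorem sub_le (hT : IsAllocation T p) (hs : 0 ≤ s) (hst : s ≤ t) (j : Fin 3) :
    T t j - T s j ≤ t - s := by
  rw [hT.eq s hs, hT.eq t (hs.trans hst)]
  exact occupationTime_sub_le _ hs hst

theorem le_sub {r : ℝ} (hT : IsAllocation T p) (hs : 0 ≤ s) (hsr : s ≤ r) (hrt : r ≤ t)
    (j : Fin 3) (h : ∀ a, r < a → a ≤ t → p j a) : t - r ≤ T t j - T s j := by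
  rw [hT.eq s hs, hT.eq t (hs.trans (hsr.trans hrt))]
  exact le_occupationTime_sub hs hsr hrt h

theorem le_add_sub {r : ℝ} (hT : IsAllocation T p) (hs : 0 ≤ s) (hsr : s ≤ r) (hrt : r ≤ t)
    (i j : Fin 3) (h : ∀ a, r < a → a ≤ t → p i a ∨ p j a) :
    t - r ≤ (T t i - T s i) + (T t j - T s j) := by
  have ht := hs.trans (hsr.trans hrt)
  rw [hT.eq s hs, hT.eq t ht, hT.eq s hs, hT.eq t ht]
  exact le_occupationTime_add_sub hs hsr hrt h

theorem count_le {R : ℝ → ℕ} {z : ℕ → ℝ} {m : ℝ} {j : Fin 3} (hT : IsAllocation T p)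
    (hz : IsRenewalPath z) (hm : 0 < m) (hR : ∀ s t, 0 ≤ s → s ≤ t → R s ≤ R t)
    (hp : ∀ s, 0 ≤ s → p j s → renewalCount m z (T s j) < R s) (ht : 0 ≤ t) :
    renewalCount m z (T t j) ≤ R t := by
  rw [hT.eq t ht]
  refine renewalCount_occupationTime_le hz hm hR (fun s hs hps => ?_) ht
  rw [← hT.eq s hs]
  exact hp s hs hps

end IsAllocation

theorem ServesClassOne.pos {L C : ℝ} {q : Fin 3 → ℝ} (h : ServesClassOne ρ L C q)
    (hρ : ρ.Positive) (hLC : L ≤ C - 1) : 0 < q 0 := by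
  rcases h with h | ⟨-, h | h⟩
  · exact h.2.1
  · exact lt_of_lt_of_le (mul_pos (div_pos (hρ.mu 0) (hρ.mu 1)) (by linarith)) h
  · exact h.2

theorem ServesClassTwo.pos {L C : ℝ} {q : Fin 3 → ℝ} (h : ServesClassTwo ρ n L C g₀ Ψ q) :
    0 < q 1 := by
  rcases h with h | h
  · exact h.2.2
  · exact h.2.2.1

/-- Standing assumptions for the pathwise analysis. -/
structure PathData (ρ : Rates) (n : ℕ) (c l₀ g₀ : ℝ) (Ψ : ℝ → ℝ) (x : Fin 2 → ℕ → ℝ)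
    (y : Fin 3 → ℕ → ℝ) (T : ℝ → Fin 3 → ℝ) : Prop where
  rates : ρ.Positive
  path_x : ∀ k, IsRenewalPath (x k)
  path_y : ∀ j, IsRenewalPath (y j)
  policy : FollowsPolicy ρ n c l₀ g₀ Ψ x y T
  thresholds : logThreshold l₀ n ≤ logThreshold (c * l₀) n - 1

namespace PathData

variable {s t H : ℝ}

theorem queueLength_zero (h : PathData ρ n c l₀ g₀ Ψ x y T) (j : Fin 3) :
    queueLength ρ x y T 0 j = 0 := by
  have hT := h.policy.isAllocation
  fin_cases j
  · simp [queueLength_apply_zero, hT.zero, (h.path_x _).renewalCount_zero (h.rates.lam _),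
      (h.path_y _).renewalCount_zero (h.rates.mu _)]
  · simp [queueLength_apply_one, hT.zero, (h.path_x _).renewalCount_zero (h.rates.lam _),
      (h.path_y _).renewalCount_zero (h.rates.mu _)]
  · simp [queueLength_apply_two, hT.zero, (h.path_y _).renewalCount_zero (h.rates.mu _)]

/-- Each class is served only when present, so its completions never overtake its arrivals. For
Class 3 the arrivals are the Class 2 completions. -/
theorem queueLength_nonneg (h : PathData ρ n c l₀ g₀ Ψ x y T) (ht : 0 ≤ t) (j : Fin 3) :
    0 ≤ queueLength ρ x y T t j := by
  have hT := h.policy.isAllocation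
  fin_cases j
  · have := hT.count_le (j := 0) (R := renewalCount (ρ.lam 0) (x 0)) (h.path_y 0) (h.rates.mu 0)
      (fun s t hs hst => (h.path_x 0).renewalCount_mono (h.rates.lam 0) hs hst)
      (fun s hs hps => by
        have := ServesClassOne.pos hps h.rates h.thresholds
        rw [queueLength_apply_zero, sub_pos] at this
        exact_mod_cast this) ht
    simp only [Fin.zero_eta]
    rw [queueLength_apply_zero, sub_nonneg]
    exact_mod_cast this
  · have := hT.count_le (j := 1) (R := renewalCount (ρ.lam 1) (x 1)) (h.path_y 1) (h.rates.mu 1)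
      (fun s t hs hst => (h.path_x 1).renewalCount_mono (h.rates.lam 1) hs hst)
      (fun s hs hps => by
        have := ServesClassTwo.pos hps
        rw [queueLength_apply_one, sub_pos] at this
        exact_mod_cast this) ht
    simp only [Fin.mk_one]
    rw [queueLength_apply_one, sub_nonneg]
    exact_mod_cast this
  · have := hT.count_le (j := 2) (R := fun s => renewalCount (ρ.mu 1) (y 1) (T s 1)) (h.path_y 2)
      (h.rates.mu 2)
      (fun s t hs hst => (h.path_y 1).renewalCount_mono (h.rates.mu 1) (hT.nonneg hs 1)
        (hT.mono hs hst 1))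
      (fun s hs hps => by
        have : 0 < queueLength ρ x y T s 2 := hps
        rw [queueLength_apply_two, sub_pos] at this
        exact_mod_cast this) ht
    simp only [Fin.reduceFinMk]
    rw [queueLength_apply_two, sub_nonneg]
    exact_mod_cast this

/-- Class 2 is in service whenever it is present and Buffer 3 is below the lower threshold. -/
theorem servesClassTwo (h : PathData ρ n c l₀ g₀ Ψ x y T) (ht : 0 ≤ t)
    (h2 : queueLength ρ x y T t 2 < logThreshold l₀ n) (h1 : 0 < queueLength ρ x y T t 1) :
    ServesClassTwo ρ n (logThreshold l₀ n) (logThreshold (c * l₀) n) g₀ Ψ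
      (queueLength ρ x y T t) := by
  have h0 : 0 ≤ ρ.mu 1 / ρ.mu 0 * queueLength ρ x y T t 0 :=
    mul_nonneg (div_pos (h.rates.mu 1) (h.rates.mu 0)).le (h.queueLength_nonneg ht 0)
  exact Or.inl ⟨by linarith, h2.trans_le h.thresholds, h1⟩

/-- Server 1 idles only when Buffer 1 is nearly empty. -/
theorem queueLength_lt_of_idle (h : PathData ρ n c l₀ g₀ Ψ x y T) (ht : 0 ≤ t)
    (h1 : ¬ ServesClassOne ρ (logThreshold l₀ n) (logThreshold (c * l₀) n)
      (queueLength ρ x y T t))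
    (h2 : ¬ ServesClassTwo ρ n (logThreshold l₀ n) (logThreshold (c * l₀) n) g₀ Ψ
      (queueLength ρ x y T t)) :
    queueLength ρ x y T t 0 <
      ρ.mu 0 / ρ.mu 1 * (logThreshold (c * l₀) n - logThreshold l₀ n + 2) := by
  have hthr := h.thresholds
  have hpos : 0 < ρ.mu 0 / ρ.mu 1 * (logThreshold (c * l₀) n - logThreshold l₀ n + 2) :=
    mul_pos (div_pos (h.rates.mu 0) (h.rates.mu 1)) (by linarith)
  have hq := h.queueLength_nonneg ht
  generalize queueLength ρ x y T t = q at *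
  by_contra hlt
  push Not at hlt
  rcases lt_or_ge (q 2 - ρ.mu 1 / ρ.mu 0 * q 0) (logThreshold l₀ n) with hr | hr
  · rcases (hq 1).eq_or_lt with hq1 | hq1
    · exact h1 (Or.inl ⟨hr, hpos.trans_le hlt, Or.inr hq1.symm⟩)
    · rcases lt_or_ge (q 2) (logThreshold (c * l₀) n - 1) with hq2 | hq2
      · exact h2 (Or.inl ⟨hr, hq2, hq1⟩)
      · exact h1 (Or.inl ⟨hr, hpos.trans_le hlt, Or.inl hq2⟩)
  · exact h1 (Or.inr ⟨hr, Or.inl hlt⟩)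

/-- Server 2 starves only when Buffer 2 is nearly empty. -/
theorem queueLength_one_le_of_starving (h : PathData ρ n c l₀ g₀ Ψ x y T) {ε κ : ℝ}
    (hA : CountRegular (renewalCount (ρ.lam 1) (x 1)) (ρ.lam 1) ε κ H)
    (hS₂ : CountRegular (renewalCount (ρ.mu 1) (y 1)) (ρ.mu 1) ε κ H)
    (hS₃ : CountRegular (renewalCount (ρ.mu 2) (y 2)) (ρ.mu 2) ε κ H)
    (hε0 : 0 ≤ ε) (hε1 : ε ≤ 1)
    (h12 : (1 + ε) * ρ.lam 1 ≤ (1 - ε) * ρ.mu 1) (h32 : (1 + ε) * ρ.mu 2 ≤ (1 - ε) * ρ.mu 1)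
    (hL : 2 * κ + 1 < logThreshold l₀ n) (ht : 0 ≤ t) (htH : t ≤ H)
    (hq : queueLength ρ x y T t 2 = 0) : queueLength ρ x y T t 1 ≤ 2 * κ + 1 := by
  have hT := h.policy.isAllocation
  have hμ := h.rates.mu 1
  -- After `r`, Buffer 3 is below `L` and Buffer 2 is nonempty, so Class 2 is served without
  -- interruption. The choice `η = 1 / μ₂` makes the gap `[s, r]` cost at most one service.
  obtain ⟨s, r, hs, hsr, hrt, hη, hps, hlast⟩ := exists_near_last_time
    (p := fun s => logThreshold l₀ n ≤ queueLength ρ x y T s 2 ∨ queueLength ρ x y T s 1 ≤ 0)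
    (t := t) (η := 1 / ρ.mu 1) (Or.inr (h.queueLength_zero 1).le) ht (by positivity)
  have hst := hsr.trans hrt
  have hserve : t - r ≤ T t 1 - T s 1 := hT.le_sub hs hsr hrt 1 fun a ha hat => by
    have hnot := hlast a ha hat
    push Not at hnot
    exact h.servesClassTwo (hs.trans (hsr.trans ha.le)) hnot.1 hnot.2
  have hη' : ρ.mu 1 * (r - s) ≤ 1 := by
    have := mul_le_mul_of_nonneg_left (sub_le_iff_le_add'.2 hη) hμ.le
    rwa [mul_one_div_cancel hμ.ne'] at this
  have e1 := (hA s t hs hst htH).1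
  have e2 := (hS₂ (T s 1) (T t 1) (hT.nonneg hs 1) (hT.mono hs hst 1)
    ((hT.le_self ht 1).trans htH)).2
  have e3 := (hS₃ (T s 2) (T t 2) (hT.nonneg hs 2) (hT.mono hs hst 2)
    ((hT.le_self ht 2).trans htH)).1
  have e4 : (1 - ε) * ρ.mu 1 * (t - s) - 1 ≤ (1 - ε) * ρ.mu 1 * (T t 1 - T s 1) := by
    have h5 : t - s - (r - s) ≤ T t 1 - T s 1 := by linarith
    have h6 := mul_le_mul_of_nonneg_left h5 (mul_nonneg (sub_nonneg.2 hε1) hμ.le)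
    have h7 : (1 - ε) * (ρ.mu 1 * (r - s)) ≤ 1 * 1 :=
      mul_le_mul (by linarith) hη' (mul_nonneg hμ.le (by linarith)) zero_le_one
    linarith
  -- If Buffer 3 held at least `L` at `s`, it has lost at most `2κ + 1 < L` customers since then, as
  -- Class 2 is served faster than Class 3, and cannot be empty at `t`. Otherwise Buffer 2 was empty
  -- at `s`, and it has gained at most `2κ + 1` because `λ₂ < μ₂`.
  rcases hps with hps | hps
  · exfalso
    have e5 : (1 + ε) * ρ.mu 2 * (T t 2 - T s 2) ≤ (1 + ε) * ρ.mu 2 * (t - s) :=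
      mul_le_mul_of_nonneg_left (hT.sub_le hs hst 2) (by have := h.rates.mu 2; positivity)
    have e6 := mul_le_mul_of_nonneg_right h32 (sub_nonneg.2 hst)
    rw [queueLength_apply_two] at hps hq
    linarith
  · have e6 := mul_le_mul_of_nonneg_right h12 (sub_nonneg.2 hst)
    rw [queueLength_apply_one] at hps ⊢
    linarith

/-- Bound on the total number of Class 2 and Class 3 customers. -/
theorem queueLength_one_add_two_le (h : PathData ρ n c l₀ g₀ Ψ x y T) {K M d : ℝ}
    (hstarve : ∀ s, 0 ≤ s → s ≤ H → queueLength ρ x y T s 2 = 0 → queueLength ρ x y T s 1 ≤ K)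
    (hA : CountNear (renewalCount (ρ.lam 1) (x 1)) (ρ.lam 1) M H)
    (hS₃ : CountNear (renewalCount (ρ.mu 2) (y 2)) (ρ.mu 2) M H)
    (hd : 0 ≤ d) (hdrift : ρ.lam 1 - ρ.mu 2 ≤ d) (ht : 0 ≤ t) (htH : t ≤ H) :
    queueLength ρ x y T t 1 + queueLength ρ x y T t 2 ≤ K + 4 * M + 1 + d * H := by
  have hT := h.policy.isAllocation
  have hμ := h.rates.mu 2
  -- In `Q₂ + Q₃` the Class 2 completions cancel, so only Class 2 arrivals and Class 3 services
  -- matter, and after `r` Server 2 never stops.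
  obtain ⟨s, r, hs, hsr, hrt, hη, hps, hlast⟩ := exists_near_last_time
    (p := fun s => queueLength ρ x y T s 2 = 0)
    (t := t) (η := 1 / ρ.mu 2) (h.queueLength_zero 2) ht (by positivity)
  have hst := hsr.trans hrt
  have hserve : t - r ≤ T t 2 - T s 2 := hT.le_sub hs hsr hrt 2 fun a ha hat =>
    lt_of_le_of_ne (h.queueLength_nonneg (hs.trans (hsr.trans ha.le)) 2)
      (Ne.symm (hlast a ha hat))
  have hη' : ρ.mu 2 * (r - s) ≤ 1 := by
    have := mul_le_mul_of_nonneg_left (sub_le_iff_le_add'.2 hη) hμ.le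
    rwa [mul_one_div_cancel hμ.ne'] at this
  have e1 := (abs_le.1 (hA.increment hs hst htH)).2
  have e2 := (abs_le.1 (hS₃.increment (hT.nonneg hs 2) (hT.mono hs hst 2)
    ((hT.le_self ht 2).trans htH))).1
  have e3 := hstarve s hs (hst.trans htH) hps
  have e4 : ρ.mu 2 * (t - s) - 1 ≤ ρ.mu 2 * (T t 2 - T s 2) := by
    have h5 : t - s - (r - s) ≤ T t 2 - T s 2 := by linarith
    have h6 := mul_le_mul_of_nonneg_left h5 hμ.le
    linarith
  have e5 : (ρ.lam 1 - ρ.mu 2) * (t - s) ≤ d * H :=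
    mul_le_mul hdrift (by linarith) (by linarith) hd
  rw [queueLength_apply_two] at hps
  rw [queueLength_apply_one] at e3
  rw [queueLength_apply_one, queueLength_apply_two]
  linarith

/-- Bound on the workload at Station 1. -/
theorem workload_zero_le (h : PathData ρ n c l₀ g₀ Ψ x y T) {K M d : ℝ}
    (hQ : ∀ s, 0 ≤ s → s ≤ H → queueLength ρ x y T s 1 + queueLength ρ x y T s 2 ≤ K)
    (hA : ∀ k, CountNear (renewalCount (ρ.lam k) (x k)) (ρ.lam k) M H)
    (hS : ∀ j, CountNear (renewalCount (ρ.mu j) (y j)) (ρ.mu j) M H)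
    (hd : 0 ≤ d) (hdrift : ρ.lam 0 / ρ.mu 0 + ρ.lam 1 / ρ.mu 1 - 1 ≤ d) (ht : 0 ≤ t)
    (htH : t ≤ H) :
    workload ρ (queueLength ρ x y T t) 0 ≤
      (logThreshold (c * l₀) n - logThreshold l₀ n + 2) / ρ.mu 1 + K / ρ.mu 1 +
        4 * M * (1 / ρ.mu 0 + 1 / ρ.mu 1) + 1 + d * H := by
  have hT := h.policy.isAllocation
  have hμ0 := h.rates.mu 0
  have hμ1 := h.rates.mu 1
  have hq0 := h.queueLength_zero
  -- The time `s` is nearly the last idle time of Server 1; the empty network at time `0` is one.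
  -- There `Q₁` is below its threshold and `Q₂` is at most `K`, and after `r` Server 1 removes work
  -- at unit rate.
  obtain ⟨s, r, hs, hsr, hrt, hη, hps, hlast⟩ := exists_near_last_time
    (p := fun s => ¬ (ServesClassOne ρ (logThreshold l₀ n) (logThreshold (c * l₀) n)
        (queueLength ρ x y T s) ∨
      ServesClassTwo ρ n (logThreshold l₀ n) (logThreshold (c * l₀) n) g₀ Ψ
        (queueLength ρ x y T s))) (t := t) (η := 1)
    (by
      rintro (h' | h')
      · exact (h'.pos h.rates h.thresholds).ne' (hq0 0)
      · exact h'.pos.ne' (hq0 1)) ht one_pos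
  push Not at hps
  have hst := hsr.trans hrt
  have hserve : t - r ≤ (T t 0 - T s 0) + (T t 1 - T s 1) :=
    hT.le_add_sub hs hsr hrt 0 1 fun a ha hat => not_not.1 (hlast a ha hat)
  have e0 := h.queueLength_lt_of_idle hs hps.1 hps.2
  have e1 := hQ s hs (hst.trans htH)
  have e2 := h.queueLength_nonneg hs 2
  have a0 := (abs_le.1 ((hA 0).increment hs hst htH)).2
  have a1 := (abs_le.1 ((hA 1).increment hs hst htH)).2
  have s0 := (abs_le.1 ((hS 0).increment (hT.nonneg hs 0) (hT.mono hs hst 0)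
    ((hT.le_self ht 0).trans htH))).1
  have s1 := (abs_le.1 ((hS 1).increment (hT.nonneg hs 1) (hT.mono hs hst 1)
    ((hT.le_self ht 1).trans htH))).1
  have e5 : (ρ.lam 0 / ρ.mu 0 + ρ.lam 1 / ρ.mu 1 - 1) * (t - s) ≤ d * H :=
    mul_le_mul hdrift (by linarith) (by linarith) hd
  have b0 : queueLength ρ x y T t 0 ≤ ρ.mu 0 / ρ.mu 1 *
      (logThreshold (c * l₀) n - logThreshold l₀ n + 2) + ρ.lam 0 * (t - s) + 4 * M -
      ρ.mu 0 * (T t 0 - T s 0) := by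
    rw [queueLength_apply_zero] at e0 ⊢
    linarith
  have b1 : queueLength ρ x y T t 1 ≤ K + ρ.lam 1 * (t - s) + 4 * M -
      ρ.mu 1 * (T t 1 - T s 1) := by
    rw [queueLength_apply_one] at e1 ⊢
    linarith
  have c0 := div_le_div_of_nonneg_right b0 hμ0.le
  have c1 := div_le_div_of_nonneg_right b1 hμ1.le
  have d0 : (ρ.mu 0 / ρ.mu 1 * (logThreshold (c * l₀) n - logThreshold l₀ n + 2) +
      ρ.lam 0 * (t - s) + 4 * M - ρ.mu 0 * (T t 0 - T s 0)) / ρ.mu 0 =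
      (logThreshold (c * l₀) n - logThreshold l₀ n + 2) / ρ.mu 1 + ρ.lam 0 / ρ.mu 0 * (t - s) +
        4 * M * (1 / ρ.mu 0) - (T t 0 - T s 0) := by
    field_simp
  have d1 : (K + ρ.lam 1 * (t - s) + 4 * M - ρ.mu 1 * (T t 1 - T s 1)) / ρ.mu 1 =
      K / ρ.mu 1 + ρ.lam 1 / ρ.mu 1 * (t - s) + 4 * M * (1 / ρ.mu 1) - (T t 1 - T s 1) := by
    field_simp
  rw [d0] at c0
  rw [d1] at c1
  change queueLength ρ x y T t 0 / ρ.mu 0 + queueLength ρ x y T t 1 / ρ.mu 1 ≤ _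
  linarith

/-- Crude bound on the queue lengths by the numbers of arrivals. -/
theorem queueLength_le_arrivals (h : PathData ρ n c l₀ g₀ Ψ x y T) (ht : 0 ≤ t) (htH : t ≤ H) :
    queueLength ρ x y T t 0 ≤ renewalCount (ρ.lam 0) (x 0) H ∧
      queueLength ρ x y T t 1 + queueLength ρ x y T t 2 ≤ renewalCount (ρ.lam 1) (x 1) H := by
  have m0 : (renewalCount (ρ.lam 0) (x 0) t : ℝ) ≤ renewalCount (ρ.lam 0) (x 0) H := by
    exact_mod_cast (h.path_x 0).renewalCount_mono (h.rates.lam 0) ht htH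
  have m1 : (renewalCount (ρ.lam 1) (x 1) t : ℝ) ≤ renewalCount (ρ.lam 1) (x 1) H := by
    exact_mod_cast (h.path_x 1).renewalCount_mono (h.rates.lam 1) ht htH
  have n0 : (0 : ℝ) ≤ renewalCount (ρ.mu 0) (y 0) (T t 0) := Nat.cast_nonneg _
  have n2 : (0 : ℝ) ≤ renewalCount (ρ.mu 2) (y 2) (T t 2) := Nat.cast_nonneg _
  rw [queueLength_apply_zero, queueLength_apply_one, queueLength_apply_two]
  constructor <;> linarith

end PathData

end Path

end Crisscross

namespace Crisscross

/-! ### Running maxima of partial sums -/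

/-- The running maximum `max (0, z₀, z₀ + z₁, …)` of the first partial sums. -/
def runMax (z : ℕ → ℝ) : ℕ → ℝ
  | 0 => 0
  | k + 1 => max (runMax z k) (∑ i ∈ Finset.range (k + 1), z i)

theorem runMax_nonneg (z : ℕ → ℝ) (k : ℕ) : 0 ≤ runMax z k := by
  induction k with
  | zero => exact le_rfl
  | succ k ih => exact ih.trans (le_max_left _ _)

theorem sum_le_runMax (z : ℕ → ℝ) {m N : ℕ} (h : m ≤ N) :
    ∑ i ∈ Finset.range m, z i ≤ runMax z N := by
  induction N with
  | zero =>
    obtain rfl : m = 0 := by omega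
    simp [runMax]
  | succ k ih =>
    rcases h.eq_or_lt with rfl | h
    · exact le_max_right _ _
    · exact (ih (by omega)).trans (le_max_left _ _)

theorem runMax_congr {z z' : ℕ → ℝ} {k : ℕ} (h : ∀ i < k, z i = z' i) :
    runMax z k = runMax z' k := by
  induction k with
  | zero => rfl
  | succ k ih =>
    have h2 : ∑ i ∈ Finset.range (k + 1), z i = ∑ i ∈ Finset.range (k + 1), z' i :=
      Finset.sum_congr rfl fun i hi => h i (Finset.mem_range.1 hi)
    rw [runMax, runMax, ih fun i hi => h i (by omega), h2]

theorem measurable_runMax (k : ℕ) : Measurable fun z : ℕ → ℝ => runMax z k := by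
  induction k with
  | zero => exact measurable_const
  | succ k ih => exact ih.max (Finset.measurable_sum _ fun i _ => measurable_pi_apply i)

/-- A pathwise form of Doob's `L²` maximal inequality. -/
theorem runMax_sq_le (z : ℕ → ℝ) (N : ℕ) :
    runMax z N ^ 2 ≤ 4 * (∑ i ∈ Finset.range N, z i) ^ 2 -
      4 * ∑ k ∈ Finset.range N, runMax z k * z k := by
  -- Summation by parts: when the maximum moves, the two sides change by amounts differing by the
  -- square of its jump. Completing the square in `M - 2S` then eliminates the cross term `M S` of
  -- the maximum `M` and the sum `S`.
  have key : 2 * ∑ k ∈ Finset.range N, runMax z k * z k ≤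
      2 * runMax z N * (∑ i ∈ Finset.range N, z i) - runMax z N ^ 2 := by
    induction N with
    | zero => simp [runMax]
    | succ k ih =>
      rw [Finset.sum_range_succ, runMax]
      rcases le_total (∑ i ∈ Finset.range (k + 1), z i) (runMax z k) with h | h
      · rw [max_eq_left h, Finset.sum_range_succ z]
        nlinarith
      · rw [max_eq_right h]
        have h3 : z k = ∑ i ∈ Finset.range (k + 1), z i - ∑ i ∈ Finset.range k, z i := by
          rw [Finset.sum_range_succ]
          ring
        rw [h3]
        nlinarith [sq_nonneg (∑ i ∈ Finset.range (k + 1), z i - runMax z k)]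
  nlinarith [sq_nonneg (runMax z N - 2 * ∑ i ∈ Finset.range N, z i)]

/-! ### Centred i.i.d. sequences with exponential moments -/

section Probability

variable {Ω : Type*} [MeasurableSpace Ω] {P : Measure Ω}

/-- Centred i.i.d. random variables with finite exponential moments near the origin. -/
structure IsCenteredIID (P : Measure Ω) (z : ℕ → Ω → ℝ) : Prop where
  meas : ∀ i, Measurable (z i)
  ident : ∀ i, IdentDistrib (z i) (z 0) P P
  indep : iIndepFun z P
  mean : ∫ ω, z 0 ω ∂P = 0
  exp_moment : 0 ∈ interior (integrableExpSet (z 0) P)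

namespace IsCenteredIID

variable {z : ℕ → Ω → ℝ}

theorem neg (h : IsCenteredIID P z) : IsCenteredIID P fun i ω => -z i ω where
  meas i := (h.meas i).neg
  ident i := (h.ident i).comp measurable_neg
  indep := h.indep.comp (fun _ => fun a => -a) fun _ => measurable_neg
  mean := by rw [integral_neg, h.mean, neg_zero]
  exp_moment := by
    have : integrableExpSet (fun ω => -z 0 ω) P = Neg.neg ⁻¹' integrableExpSet (z 0) P := by
      ext t
      simp [integrableExpSet]
    rw [this, mem_interior_iff_mem_nhds]
    refine continuous_neg.continuousAt.preimage_mem_nhds ?_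
    rw [neg_zero]
    exact mem_interior_iff_mem_nhds.1 h.exp_moment

theorem memLp (h : IsCenteredIID P z) (i : ℕ) : MemLp (z i) 2 P := by
  rw [(h.ident i).memLp_iff]
  exact memLp_of_mem_interior_integrableExpSet h.exp_moment 2

theorem integral_eq_zero (h : IsCenteredIID P z) (i : ℕ) : ∫ ω, z i ω ∂P = 0 := by
  rw [(h.ident i).integral_eq, h.mean]

theorem memLp_sum (h : IsCenteredIID P z) (k : ℕ) :
    MemLp (fun ω => ∑ i ∈ Finset.range k, z i ω) 2 P :=
  memLp_finsetSum _ fun i _ => h.memLp i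

theorem memLp_runMax [IsProbabilityMeasure P] (h : IsCenteredIID P z) (k : ℕ) :
    MemLp (fun ω => runMax (fun i => z i ω) k) 2 P := by
  induction k with
  | zero => exact memLp_const 0
  | succ k ih => exact ih.sup (h.memLp_sum (k + 1))

/-- The running maximum at `k` depends only on the terms before index `k`, so it is independent of
the centred variable `z k`. Thus the martingale term of `runMax_sq_le` has mean zero. -/
theorem integral_runMax_mul [IsProbabilityMeasure P] (h : IsCenteredIID P z) (k : ℕ) :
    ∫ ω, runMax (fun i => z i ω) k * z k ω ∂P = 0 := by
  have hind := h.indep.indepFun_finset (Finset.range k) {k} (by simp) h.meas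
  -- The finite tuple is padded by zeros; by `runMax_congr` the padding has no effect.
  let f : (Finset.range k → ℝ) → ℝ := fun a =>
    runMax (fun i => if hi : i ∈ Finset.range k then a ⟨i, hi⟩ else 0) k
  have hf : Measurable f := by
    refine (measurable_runMax k).comp (measurable_pi_lambda _ fun i => ?_)
    by_cases hi : i ∈ Finset.range k
    · simp only [hi, dite_true]
      exact measurable_pi_apply _
    · simp only [hi, dite_false]
      exact measurable_const
  let g : (({k} : Finset ℕ) → ℝ) → ℝ := fun a => a ⟨k, by simp⟩
  have hg : Measurable g :=
    measurable_pi_apply (X := fun _ => ℝ) (⟨k, by simp⟩ : ({k} : Finset ℕ))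
  have h2 := hind.comp (φ := f) (ψ := g) hf hg
  have h3 : (f ∘ fun ω (i : Finset.range k) => z i ω) = fun ω => runMax (fun i => z i ω) k := by
    funext ω
    refine runMax_congr fun i hi => ?_
    simp [Finset.mem_range.2 hi]
  rw [h3] at h2
  have h4 : IndepFun (fun ω => runMax (fun i => z i ω) k) (z k) P := h2
  rw [h4.integral_fun_mul_eq_mul_integral (h.memLp_runMax k).1 (h.memLp k).1,
    h.integral_eq_zero k, mul_zero]

theorem integral_sum_sq [IsProbabilityMeasure P] (h : IsCenteredIID P z) (N : ℕ) :
    ∫ ω, (∑ i ∈ Finset.range N, z i ω) ^ 2 ∂P = N * ∫ ω, z 0 ω ^ 2 ∂P := by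
  have h1 := IndepFun.variance_sum (X := z) (s := Finset.range N) (fun i _ => h.memLp i)
    fun i _ j _ hij => h.indep.indepFun hij
  have h2 : (∑ i ∈ Finset.range N, z i) = fun ω => ∑ i ∈ Finset.range N, z i ω := by
    funext ω
    simp
  have h3 : ∫ ω, ∑ i ∈ Finset.range N, z i ω ∂P = 0 := by
    rw [integral_finsetSum _ fun i _ => (h.memLp i).integrable (by norm_num)]
    exact Finset.sum_eq_zero fun i _ => h.integral_eq_zero i
  rw [h2, variance_of_integral_eq_zero (h.memLp_sum N).1.aemeasurable h3] at h1
  rw [h1, ← variance_of_integral_eq_zero (h.memLp 0).1.aemeasurable h.mean,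
    Finset.sum_congr rfl fun i _ => (h.ident i).variance_eq]
  simp

theorem lintegral_runMax_sq_le [IsProbabilityMeasure P] (h : IsCenteredIID P z) (N : ℕ) :
    ∫⁻ ω, ENNReal.ofReal (runMax (fun i => z i ω) N ^ 2) ∂P ≤
      ENNReal.ofReal (4 * (∫ ω, z 0 ω ^ 2 ∂P) * N) := by
  rw [← ofReal_integral_eq_lintegral_ofReal (h.memLp_runMax N).integrable_sq
    (Eventually.of_forall fun ω => sq_nonneg _)]
  refine ENNReal.ofReal_le_ofReal ?_
  have hint : ∀ k, Integrable (fun ω => runMax (fun i => z i ω) k * z k ω) P := fun k =>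
    (h.memLp_runMax k).integrable_mul (h.memLp k)
  have hsum : Integrable (fun ω => ∑ k ∈ Finset.range N, runMax (fun i => z i ω) k * z k ω) P :=
    integrable_finsetSum _ fun k _ => hint k
  have hsq := (h.memLp_sum N).integrable_sq
  calc ∫ ω, runMax (fun i => z i ω) N ^ 2 ∂P
      ≤ ∫ ω, (4 * (∑ i ∈ Finset.range N, z i ω) ^ 2 -
          4 * ∑ k ∈ Finset.range N, runMax (fun i => z i ω) k * z k ω) ∂P :=
        integral_mono (h.memLp_runMax N).integrable_sq ((hsq.const_mul 4).sub (hsum.const_mul 4))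
          fun ω => runMax_sq_le _ N
    _ = 4 * (N * ∫ ω, z 0 ω ^ 2 ∂P) - 4 * 0 := by
        rw [integral_sub (hsq.const_mul 4) (hsum.const_mul 4), integral_const_mul,
          integral_const_mul, h.integral_sum_sq, integral_finsetSum _ fun k _ => hint k,
          Finset.sum_eq_zero fun k _ => h.integral_runMax_mul k]
    _ = _ := by ring

/-! ### Exponential tail bounds. -/

theorem eventually_mgf_le [IsProbabilityMeasure P] (h : IsCenteredIID P z) {ε : ℝ} (hε : 0 < ε) :
    ∀ᶠ θ in 𝓝[>] (0 : ℝ), Integrable (fun ω => Real.exp (θ * z 0 ω)) P ∧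
      mgf (z 0) P θ ≤ Real.exp (ε * θ) := by
  have h1 : ∀ᶠ θ in 𝓝 (0 : ℝ), Integrable (fun ω => Real.exp (θ * z 0 ω)) P :=
    mem_interior_iff_mem_nhds.1 h.exp_moment
  have hd := hasDerivAt_mgf h.exp_moment
  simp only [zero_mul, Real.exp_zero, mul_one, h.mean] at hd
  rw [hasDerivAt_iff_isLittleO] at hd
  have h2 := hd.def hε
  filter_upwards [nhdsWithin_le_nhds h1, nhdsWithin_le_nhds h2, self_mem_nhdsWithin]
    with θ hθ1 hθ2 hθ3
  refine ⟨hθ1, ?_⟩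
  have hpos : (0 : ℝ) < θ := hθ3
  simp only [mgf_zero, smul_zero, sub_zero, Real.norm_eq_abs, abs_of_pos hpos] at hθ2
  have := (abs_le.1 hθ2).2
  linarith [Real.add_one_le_exp (ε * θ)]

/-- Chernoff's bound. With `a = ε * s.card + κ` the right side becomes `exp (-θ κ)`, independent of
the block length, which allows one logarithmic `κ` for all blocks. -/
theorem measure_sum_ge_le [IsProbabilityMeasure P] (h : IsCenteredIID P z) {ε θ : ℝ}
    (hθ : 0 ≤ θ) (hint : Integrable (fun ω => Real.exp (θ * z 0 ω)) P)
    (hmgf : mgf (z 0) P θ ≤ Real.exp (ε * θ)) (s : Finset ℕ) (a : ℝ) :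
    P {ω | a ≤ ∑ i ∈ s, z i ω} ≤ ENNReal.ofReal (Real.exp (-θ * a + ε * θ * s.card)) := by
  have hi : ∀ i ∈ s, Integrable (fun ω => Real.exp (θ * z i ω)) P := fun i _ =>
    ((h.ident i).comp (u := fun a => Real.exp (θ * a)) (by fun_prop)).integrable_iff.2 hint
  have h1 := measure_ge_le_exp_mul_mgf a hθ (h.indep.integrable_exp_mul_sum h.meas hi)
  rw [h.indep.mgf_sum h.meas] at h1
  have h2 : ∏ i ∈ s, mgf (z i) P θ ≤ Real.exp (ε * θ) ^ s.card := by
    rw [← Finset.prod_const]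
    refine Finset.prod_le_prod (fun i _ => mgf_nonneg) fun i _ => ?_
    rw [mgf_congr_identDistrib (h.ident i)]
    exact hmgf
  have h3 : P.real {ω | a ≤ (∑ i ∈ s, z i) ω} ≤ Real.exp (-θ * a + ε * θ * s.card) := by
    refine h1.trans ?_
    rw [Real.exp_add, mul_comm (ε * θ), Real.exp_nat_mul]
    exact mul_le_mul_of_nonneg_left h2 (Real.exp_pos _).le
  simp only [Finset.sum_apply] at h3
  rw [← ENNReal.ofReal_toReal (measure_ne_top P {ω | a ≤ ∑ i ∈ s, z i ω})]
  exact ENNReal.ofReal_le_ofReal h3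

end IsCenteredIID

end Probability

end Crisscross

namespace Crisscross

/-! ### Renewal sequences -/

/-- Largest absolute centred partial sum up to index `N`, up to a factor two. -/
noncomputable def maxDev (x : ℕ → ℝ) (N : ℕ) : ℝ :=
  runMax (fun i => x i - 1) N + runMax (fun i => -(x i - 1)) N

theorem maxDev_nonneg (x : ℕ → ℝ) (N : ℕ) : 0 ≤ maxDev x N :=
  add_nonneg (runMax_nonneg _ _) (runMax_nonneg _ _)

theorem abs_sum_le_maxDev (x : ℕ → ℝ) {m N : ℕ} (h : m ≤ N) :
    |∑ i ∈ Finset.range m, (x i - 1)| ≤ maxDev x N := by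
  have h1 := sum_le_runMax (fun i => x i - 1) h
  have h2 := sum_le_runMax (fun i => -(x i - 1)) h
  have h3 := runMax_nonneg (fun i => x i - 1) N
  have h4 := runMax_nonneg (fun i => -(x i - 1)) N
  rw [Finset.sum_neg_distrib] at h2
  unfold maxDev
  rw [abs_le]
  constructor <;> linarith

/-- The sum of `m²` over the indices `m` for which the `m`-th partial sum is at most `m / 2`. -/
noncomputable def slowSum (x : ℕ → ℝ) : ℝ≥0∞ :=
  ∑' m : ℕ, {z : ℕ → ℝ | ∑ i ∈ Finset.range m, z i ≤ (m : ℝ) / 2}.indicator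
    (fun _ => (m : ℝ≥0∞) ^ 2) x

/-- Nonzero terms with `m ≥ 1` are at least one, so a finite sum has finitely many of them:
eventually the partial sums exceed `m / 2`. -/
theorem unbounded_of_slowSum_ne_top {x : ℕ → ℝ} (h : slowSum x ≠ ⊤) (B : ℝ) :
    ∃ m : ℕ, B < ∑ i ∈ Finset.range m, x i := by
  have h1 := (ENNReal.tendsto_atTop_zero_of_tsum_ne_top h).eventually_lt_const
    (zero_lt_one : (0 : ℝ≥0∞) < 1)
  obtain ⟨m, hm1, hm2, hm3⟩ := (h1.and ((eventually_ge_atTop 1).and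
    (eventually_ge_atTop ⌈2 * B⌉₊))).exists
  refine ⟨m, ?_⟩
  by_contra hle
  push Not at hle
  have hB : 2 * B ≤ m := Nat.ceil_le.1 hm3
  rw [indicator_of_mem (by rw [Set.mem_ofPred_eq]; linarith)] at hm1
  have h2 : (1 : ℝ≥0∞) ≤ (m : ℝ≥0∞) := by exact_mod_cast hm2
  exact absurd (hm1.trans_le (one_le_pow₀ h2)) (lt_irrefl _)

/-- A count `m > N` means that the `m`-th partial sum is at most `ρ H ≤ m / 2`, so `m²` is itself a
term of `slowSum`. The excess over `N²` is thus controlled uniformly in `H`. -/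
theorem IsRenewalPath.renewalCount_sq_le {x : ℕ → ℝ} {ρ H : ℝ} {N : ℕ} (hx : IsRenewalPath x)
    (hρ : 0 < ρ) (hH : 0 ≤ H) (hN : 2 * (ρ * H) ≤ N) :
    (renewalCount ρ x H : ℝ≥0∞) ^ 2 ≤ (N : ℝ≥0∞) ^ 2 + slowSum x := by
  rcases le_or_gt (renewalCount ρ x H) N with h | h
  · have : (renewalCount ρ x H : ℝ≥0∞) ≤ N := by exact_mod_cast h
    exact (pow_le_pow_left' this 2).trans le_self_add
  · have h1 := hx.sum_le hρ hH
    have h2 : (N : ℝ) ≤ renewalCount ρ x H := by exact_mod_cast h.le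
    refine le_trans ?_ le_add_self
    refine le_trans ?_ (ENNReal.le_tsum (renewalCount ρ x H))
    rw [indicator_of_mem (by rw [Set.mem_ofPred_eq]; linarith)]

section Probability

variable {Ω : Type*} [MeasurableSpace Ω] {P : Measure Ω}

/-- Positive i.i.d. random variables with mean one and finite exponential moments near the
origin. -/
structure IsRenewalSequence (P : Measure Ω) (x : ℕ → Ω → ℝ) : Prop where
  meas : ∀ i, Measurable (x i)
  pos : ∀ i, ∀ᵐ ω ∂P, 0 < x i ω
  centered : IsCenteredIID P fun i ω => x i ω - 1

theorem isCenteredIID_sub_one [IsProbabilityMeasure P] {x : ℕ → Ω → ℝ}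
    (meas : ∀ i, Measurable (x i)) (ident : ∀ i, IdentDistrib (x i) (x 0) P P)
    (indep : iIndepFun x P) (mean : ∫ ω, x 0 ω ∂P = 1)
    (exp_moment : ∀ᶠ l in 𝓝 (0 : ℝ), Integrable (fun ω => Real.exp (l * x 0 ω)) P) :
    IsCenteredIID P fun i ω => x i ω - 1 where
  meas i := (meas i).sub_const 1
  ident i := (ident i).comp (measurable_id.sub_const 1)
  indep := indep.comp (fun _ => fun a => a - 1) fun _ => measurable_id.sub_const 1
  mean := by
    have hint : Integrable (x 0) P := by
      -- The integral of a non-integrable function is `0` by convention, so mean one forces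
      -- integrability.
      by_contra hni
      rw [integral_undef hni] at mean
      exact zero_ne_one mean
    rw [integral_sub hint (integrable_const _), mean]
    simp
  exp_moment := by
    rw [mem_interior_iff_mem_nhds]
    filter_upwards [exp_moment] with l hl
    have : (fun ω => Real.exp (l * (x 0 ω - 1))) =
        fun ω => Real.exp (l * x 0 ω) * Real.exp (-l) := by
      funext ω
      rw [← Real.exp_add]
      ring_nf
    change Integrable (fun ω => Real.exp (l * (x 0 ω - 1))) P
    rw [this]
    exact hl.mul_const _

/-- `θ` is a Chernoff exponent for the slope `ε`. -/
structure ChernoffExponent (P : Measure Ω) (x : ℕ → Ω → ℝ) (ε θ : ℝ) : Prop where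
  tail : ∀ (s : Finset ℕ) (a : ℝ), P {ω | a ≤ |∑ i ∈ s, (x i ω - 1)|} ≤
    2 * ENNReal.ofReal (Real.exp (-θ * a + ε * θ * s.card))

namespace IsRenewalSequence

variable {x : ℕ → Ω → ℝ} [IsProbabilityMeasure P]

theorem eventually_chernoffExponent (h : IsRenewalSequence P x) {ε : ℝ} (hε : 0 < ε) :
    ∀ᶠ θ in 𝓝[>] (0 : ℝ), ChernoffExponent P x ε θ := by
  filter_upwards [h.centered.eventually_mgf_le hε, h.centered.neg.eventually_mgf_le hε,
    self_mem_nhdsWithin] with θ h1 h2 h3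
  have hθ : (0 : ℝ) ≤ θ := le_of_lt h3
  refine ⟨fun s a => ?_⟩
  have hsub : {ω | a ≤ |∑ i ∈ s, (x i ω - 1)|} ⊆ {ω | a ≤ ∑ i ∈ s, (x i ω - 1)} ∪
      {ω | a ≤ ∑ i ∈ s, -(x i ω - 1)} := by
    intro ω hω
    rw [mem_union, mem_ofPred_eq, mem_ofPred_eq, Finset.sum_neg_distrib]
    exact le_abs.1 hω
  refine (measure_mono hsub).trans ((measure_union_le _ _).trans ?_)
  rw [two_mul]
  exact add_le_add (h.centered.measure_sum_ge_le hθ h1.1 h1.2 s a)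
    (h.centered.neg.measure_sum_ge_le hθ h2.1 h2.2 s a)

/-- A deviation of `m / 2` against slope `1 / 4` has probability at most `2 exp (-θ m / 4)`, which
is summable against `m²`. -/
theorem lintegral_slowSum_lt_top (h : IsRenewalSequence P x) :
    ∫⁻ ω, slowSum (fun i => x i ω) ∂P < ⊤ := by
  obtain ⟨θ, hθ, hθ0⟩ := ((h.eventually_chernoffExponent (by norm_num : (0 : ℝ) < 1 / 4)).and
    self_mem_nhdsWithin).exists
  have hθ0 : (0 : ℝ) < θ := hθ0
  have hmeas : ∀ m : ℕ, MeasurableSet {z : ℕ → ℝ | ∑ i ∈ Finset.range m, z i ≤ (m : ℝ) / 2} :=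
    fun m => measurableSet_le (Finset.measurable_sum _ fun i _ => measurable_pi_apply i)
      measurable_const
  have hx : Measurable fun ω i => x i ω := measurable_pi_lambda _ h.meas
  unfold slowSum
  have hterm_meas : ∀ m : ℕ, AEMeasurable (fun ω =>
      {z : ℕ → ℝ | ∑ i ∈ Finset.range m, z i ≤ (m : ℝ) / 2}.indicator
        (fun _ => (m : ℝ≥0∞) ^ 2) (fun i => x i ω)) P :=
    fun m => ((measurable_const.indicator (hmeas m)).comp hx).aemeasurable
  rw [lintegral_tsum hterm_meas]
  have hterm : ∀ m : ℕ, ∫⁻ ω, {z : ℕ → ℝ | ∑ i ∈ Finset.range m, z i ≤ (m : ℝ) / 2}.indicator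
      (fun _ => (m : ℝ≥0∞) ^ 2) (fun i => x i ω) ∂P ≤
      ENNReal.ofReal (2 * ((m : ℝ) ^ 2 * Real.exp (-(θ / 4) * m))) := by
    intro m
    have h1 : ∀ ω, {z : ℕ → ℝ | ∑ i ∈ Finset.range m, z i ≤ (m : ℝ) / 2}.indicator
        (fun _ => (m : ℝ≥0∞) ^ 2) (fun i => x i ω) ≤
        {ω | (m : ℝ) / 2 ≤ |∑ i ∈ Finset.range m, (x i ω - 1)|}.indicator
          (fun _ => (m : ℝ≥0∞) ^ 2) ω := by
      intro ω
      by_cases hω : (fun i => x i ω) ∈ {z : ℕ → ℝ | ∑ i ∈ Finset.range m, z i ≤ (m : ℝ) / 2}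
      · rw [indicator_of_mem hω, indicator_of_mem]
        have h2 : ∑ i ∈ Finset.range m, x i ω ≤ (m : ℝ) / 2 := hω
        have h3 := neg_le_abs (∑ i ∈ Finset.range m, (x i ω - 1))
        rw [Finset.sum_sub_distrib] at h3
        simp only [Finset.sum_const, Finset.card_range, nsmul_eq_mul, mul_one] at h3
        rw [Set.mem_ofPred_eq, Finset.sum_sub_distrib]
        simp only [Finset.sum_const, Finset.card_range, nsmul_eq_mul, mul_one]
        linarith
      · rw [indicator_of_notMem hω]
        exact zero_le
    refine (lintegral_mono h1).trans ((lintegral_indicator_const_le _ _).trans ?_)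
    refine (mul_le_mul_right (hθ.tail (Finset.range m) ((m : ℝ) / 2)) _).trans ?_
    have h4 : (m : ℝ≥0∞) ^ 2 = ENNReal.ofReal ((m : ℝ) ^ 2) := by
      rw [ENNReal.ofReal_pow (Nat.cast_nonneg m), ENNReal.ofReal_natCast]
    have h5 : (2 : ℝ≥0∞) = ENNReal.ofReal 2 := by simp
    rw [h4, h5, ← ENNReal.ofReal_mul (by norm_num), ← ENNReal.ofReal_mul (by positivity)]
    refine ENNReal.ofReal_le_ofReal (le_of_eq ?_)
    rw [Finset.card_range,
      show -θ * ((m : ℝ) / 2) + 1 / 4 * θ * m = -(θ / 4) * m by ring]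
    ring
  refine (ENNReal.tsum_le_tsum hterm).trans_lt (Summable.tsum_ofReal_lt_top ?_)
  exact (Real.summable_pow_mul_exp_neg_nat_mul 2 (by positivity)).mul_left 2

theorem ae_isRenewalPath (h : IsRenewalSequence P x) :
    ∀ᵐ ω ∂P, IsRenewalPath fun i => x i ω := by
  have hx : Measurable fun ω i => x i ω := measurable_pi_lambda _ h.meas
  have hmeas : Measurable fun ω => slowSum fun i => x i ω := by
    refine Measurable.comp (g := slowSum) ?_ hx
    refine Measurable.tsum fun m => measurable_const.indicator ?_
    exact measurableSet_le (Finset.measurable_sum _ fun i _ => measurable_pi_apply i)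
      measurable_const
  filter_upwards [ae_all_iff.2 h.pos, ae_lt_top hmeas h.lintegral_slowSum_lt_top.ne] with ω h1 h2
  exact ⟨h1, unbounded_of_slowSum_ne_top h2.ne⟩

theorem exists_lintegral_maxDev_sq_le (h : IsRenewalSequence P x) :
    ∃ V : ℝ, 0 ≤ V ∧ ∀ N : ℕ, ∫⁻ ω, ENNReal.ofReal (maxDev (fun i => x i ω) N ^ 2) ∂P ≤
      ENNReal.ofReal (V * N) := by
  have hV : 0 ≤ ∫ ω, (x 0 ω - 1) ^ 2 ∂P := integral_nonneg fun ω => sq_nonneg _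
  refine ⟨16 * ∫ ω, (x 0 ω - 1) ^ 2 ∂P, by positivity, fun N => ?_⟩
  have h1 := h.centered.lintegral_runMax_sq_le N
  have h2 := h.centered.neg.lintegral_runMax_sq_le N
  simp only [neg_sq] at h2
  have hmeas : Measurable fun ω => ENNReal.ofReal (runMax (fun i => x i ω - 1) N ^ 2) :=
    (((measurable_runMax N).comp (measurable_pi_lambda _ h.centered.meas)).pow_const 2).ennreal_ofReal
  calc ∫⁻ ω, ENNReal.ofReal (maxDev (fun i => x i ω) N ^ 2) ∂P
      ≤ ∫⁻ ω, 2 * (ENNReal.ofReal (runMax (fun i => x i ω - 1) N ^ 2) +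
          ENNReal.ofReal (runMax (fun i => -(x i ω - 1)) N ^ 2)) ∂P := by
        refine lintegral_mono fun ω => ?_
        rw [← ENNReal.ofReal_add (sq_nonneg _) (sq_nonneg _),
          show (2 : ℝ≥0∞) = ENNReal.ofReal 2 by simp, ← ENNReal.ofReal_mul (by norm_num)]
        exact ENNReal.ofReal_le_ofReal add_sq_le
    _ = 2 * (∫⁻ ω, ENNReal.ofReal (runMax (fun i => x i ω - 1) N ^ 2) ∂P +
          ∫⁻ ω, ENNReal.ofReal (runMax (fun i => -(x i ω - 1)) N ^ 2) ∂P) := by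
        rw [lintegral_const_mul' _ _ (by simp), lintegral_add_left hmeas]
    _ ≤ 2 * (ENNReal.ofReal (4 * (∫ ω, (x 0 ω - 1) ^ 2 ∂P) * N) +
          ENNReal.ofReal (4 * (∫ ω, (x 0 ω - 1) ^ 2 ∂P) * N)) := by gcongr
    _ = _ := by
        rw [← ENNReal.ofReal_add (by positivity) (by positivity),
          show (2 : ℝ≥0∞) = ENNReal.ofReal 2 by simp, ← ENNReal.ofReal_mul (by norm_num)]
        congr 1
        ring

end IsRenewalSequence

/-- Union bound over at most `(N + 1)²` pairs of block endpoints. -/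
theorem ChernoffExponent.measure_not_blockRegular_le {x : ℕ → Ω → ℝ} {ε θ : ℝ}
    (h : ChernoffExponent P x ε θ) (κ : ℝ) (N : ℕ) :
    P {ω | ¬ BlockRegular (fun i => x i ω) ε κ N} ≤
      ENNReal.ofReal (2 * ((N : ℝ) + 1) ^ 2 * Real.exp (-θ * κ)) := by
  have hsub : {ω | ¬ BlockRegular (fun i => x i ω) ε κ N} ⊆
      ⋃ p ∈ Finset.range (N + 1) ×ˢ Finset.range (N + 1),
        {ω | ε * ((Finset.Ico p.1 p.2).card : ℝ) + κ ≤
          |∑ i ∈ Finset.Ico p.1 p.2, (x i ω - 1)|} := by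
    intro ω hω
    rw [Set.mem_ofPred_eq, BlockRegular] at hω
    push Not at hω
    obtain ⟨l, m, hlm, hmN, hlt⟩ := hω
    refine mem_iUnion₂.2 ⟨(l, m), ?_, ?_⟩
    · simp only [Finset.mem_product, Finset.mem_range]
      omega
    · rw [Set.mem_ofPred_eq, Nat.card_Ico, Nat.cast_sub hlm]
      exact hlt.le
  refine (measure_mono hsub).trans ((measure_biUnion_finset_le _ _).trans ?_)
  have hterm : ∀ p ∈ Finset.range (N + 1) ×ˢ Finset.range (N + 1),
      P {ω | ε * ((Finset.Ico p.1 p.2).card : ℝ) + κ ≤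
        |∑ i ∈ Finset.Ico p.1 p.2, (x i ω - 1)|} ≤
      ENNReal.ofReal (2 * Real.exp (-θ * κ)) := by
    intro p _
    refine (h.tail _ _).trans ?_
    rw [show (2 : ℝ≥0∞) = ENNReal.ofReal 2 by simp, ← ENNReal.ofReal_mul (by norm_num)]
    refine ENNReal.ofReal_le_ofReal (le_of_eq ?_)
    congr 2
    ring
  refine (Finset.sum_le_sum hterm).trans ?_
  rw [Finset.sum_const, Finset.card_product, Finset.card_range, nsmul_eq_mul,
    ← ENNReal.ofReal_natCast, ← ENNReal.ofReal_mul (by positivity)]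
  refine ENNReal.ofReal_le_ofReal (le_of_eq ?_)
  push_cast
  ring

end Probability

end Crisscross

namespace Crisscross

/-! ### Pathwise bounds on the workloads -/

/-- All five primitive sequences are block regular. -/
def AllRegular (x : Fin 2 → ℕ → ℝ) (y : Fin 3 → ℕ → ℝ) (ε κ : ℝ) (N : ℕ) : Prop :=
  (∀ k, BlockRegular (x k) ε κ N) ∧ ∀ j, BlockRegular (y j) ε κ N

/-- Sum of the maximal deviations of the five primitive sequences. -/
noncomputable def totalDev (x : Fin 2 → ℕ → ℝ) (y : Fin 3 → ℕ → ℝ) (N : ℕ) : ℝ :=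
  ∑ k, maxDev (x k) N + ∑ j, maxDev (y j) N

theorem maxDev_le_totalDev_left (x : Fin 2 → ℕ → ℝ) (y : Fin 3 → ℕ → ℝ) (N : ℕ) (k : Fin 2) :
    maxDev (x k) N ≤ totalDev x y N := by
  have h1 := Finset.single_le_sum (f := fun k => maxDev (x k) N) (fun k _ => maxDev_nonneg _ _)
    (Finset.mem_univ k)
  have h2 : 0 ≤ ∑ j, maxDev (y j) N := Finset.sum_nonneg fun j _ => maxDev_nonneg _ _
  exact h1.trans (le_add_of_nonneg_right h2)

theorem maxDev_le_totalDev_right (x : Fin 2 → ℕ → ℝ) (y : Fin 3 → ℕ → ℝ) (N : ℕ) (j : Fin 3) :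
    maxDev (y j) N ≤ totalDev x y N := by
  have h1 := Finset.single_le_sum (f := fun j => maxDev (y j) N) (fun j _ => maxDev_nonneg _ _)
    (Finset.mem_univ j)
  have h2 : 0 ≤ ∑ k, maxDev (x k) N := Finset.sum_nonneg fun k _ => maxDev_nonneg _ _
  exact h1.trans (le_add_of_nonneg_left h2)

theorem totalDev_nonneg (x : Fin 2 → ℕ → ℝ) (y : Fin 3 → ℕ → ℝ) (N : ℕ) : 0 ≤ totalDev x y N :=
  (maxDev_nonneg _ _).trans (maxDev_le_totalDev_left x y N 0)

theorem totalDev_sq_le (x : Fin 2 → ℕ → ℝ) (y : Fin 3 → ℕ → ℝ) (N : ℕ) :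
    totalDev x y N ^ 2 ≤ 5 * (∑ k, maxDev (x k) N ^ 2 + ∑ j, maxDev (y j) N ^ 2) := by
  have h1 := sq_sum_le_card_mul_sum_sq (s := Finset.univ)
    (f := Sum.elim (fun k => maxDev (x k) N) (fun j => maxDev (y j) N))
  simp only [Fintype.sum_sum_type, Sum.elim_inl, Sum.elim_inr, Finset.card_univ,
    Fintype.card_sum, Fintype.card_fin] at h1
  exact_mod_cast h1

/-- Quantitative assumptions on the rates of a network, with constants `Λ` (size of the rates), `ε`
(slack in the service rate of Class 2) and `d` (distance from criticality). -/
structure Rates.Bounds (ρ : Rates) (Λ ε d : ℝ) : Prop where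
  lam_pos : ∀ k, 0 < ρ.lam k
  mu_pos : ∀ j, 0 < ρ.mu j
  one_le : 1 ≤ Λ
  lam_le : ∀ k, ρ.lam k ≤ Λ
  mu_le : ∀ j, ρ.mu j ≤ Λ
  mu_inv_le : ∀ j, 1 / ρ.mu j ≤ Λ
  eps_pos : 0 < ε
  eps_le : ε ≤ 1 / 4
  slack_lam : (1 + 2 * ε) * ρ.lam 1 ≤ (1 - 2 * ε) * ρ.mu 1
  slack_mu : (1 + 2 * ε) * ρ.mu 2 ≤ (1 - 2 * ε) * ρ.mu 1
  drift_nonneg : 0 ≤ d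
  drift_one : ρ.lam 0 / ρ.mu 0 + ρ.lam 1 / ρ.mu 1 - 1 ≤ d
  drift_two : ρ.lam 1 - ρ.mu 2 ≤ d

theorem workload_apply_zero (ρ : Rates) (q : Fin 3 → ℝ) :
    workload ρ q 0 = q 0 / ρ.mu 0 + q 1 / ρ.mu 1 := rfl

theorem workload_apply_one (ρ : Rates) (q : Fin 3 → ℝ) :
    workload ρ q 1 = (q 1 + q 2) / ρ.mu 2 := by
  rw [add_div]
  rfl

section Path

variable {ρ : Rates} {n : ℕ} {c l₀ g₀ : ℝ} {Ψ : ℝ → ℝ} {x : Fin 2 → ℕ → ℝ} {y : Fin 3 → ℕ → ℝ}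
  {T : ℝ → Fin 3 → ℝ} {Λ ε d κ H : ℝ} {N : ℕ}

theorem PathData.workload_le_of_allRegular (h : PathData ρ n c l₀ g₀ Ψ x y T)
    (hb : ρ.Bounds Λ ε d) (hκ : 0 ≤ κ) (hH : 0 ≤ H) (hN : 2 * (Λ * H + κ) < N)
    (hreg : AllRegular x y ε κ N) (hL : 4 * κ + 3 < logThreshold l₀ n) {t : ℝ} (ht : 0 ≤ t)
    (htH : t ≤ H) (i : Fin 2) :
    workload ρ (queueLength ρ x y T t) i ≤ 32 * Λ * (totalDev x y N +
      (κ + (logThreshold (c * l₀) n - logThreshold l₀ n) + 1 + d * H)) := by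
  have hΛ := hb.one_le
  have hε := hb.eps_le
  have hNρ : ∀ {a : ℝ}, a ≤ Λ → 2 * (a * H + κ) < N := fun ha => by
    have := mul_le_mul_of_nonneg_right ha hH
    linarith
  have hx : ∀ k, renewalCount (ρ.lam k) (x k) H < N := fun k =>
    (hreg.1 k).renewalCount_lt (h.path_x k) (hb.lam_pos k) hH (by linarith) (hNρ (hb.lam_le k))
  have hy : ∀ j, renewalCount (ρ.mu j) (y j) H < N := fun j =>
    (hreg.2 j).renewalCount_lt (h.path_y j) (hb.mu_pos j) hH (by linarith) (hNρ (hb.mu_le j))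
  have hyreg : ∀ j, CountRegular (renewalCount (ρ.mu j) (y j)) (ρ.mu j) (2 * ε) (2 * κ + 1) H :=
    fun j => (hreg.2 j).countRegular (h.path_y j) (hb.mu_pos j) hH hb.eps_pos (by linarith) hκ
      (hNρ (hb.mu_le j))
  have hxnear : ∀ k, CountNear (renewalCount (ρ.lam k) (x k)) (ρ.lam k) (totalDev x y N + 1) H :=
    fun k => (h.path_x k).countNear (hb.lam_pos k) (hx k) fun m hm =>
      (abs_sum_le_maxDev (x k) hm).trans (maxDev_le_totalDev_left x y N k)
  have hynear : ∀ j, CountNear (renewalCount (ρ.mu j) (y j)) (ρ.mu j) (totalDev x y N + 1) H :=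
    fun j => (h.path_y j).countNear (hb.mu_pos j) (hy j) fun m hm =>
      (abs_sum_le_maxDev (y j) hm).trans (maxDev_le_totalDev_right x y N j)
  -- Passing from sums to counts turned `κ` into `2κ + 1`; inserting that in the starvation bound
  -- gives `4κ + 3`, the quantity that `L` must exceed.
  have hstarve : ∀ s, 0 ≤ s → s ≤ H → queueLength ρ x y T s 2 = 0 →
      queueLength ρ x y T s 1 ≤ 2 * (2 * κ + 1) + 1 := fun s hs hsH hq =>
    h.queueLength_one_le_of_starving
      ((hreg.1 1).countRegular (h.path_x 1) (hb.lam_pos 1) hH hb.eps_pos (by linarith) hκ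
        (hNρ (hb.lam_le 1))) (hyreg 1) (hyreg 2) (by linarith [hb.eps_pos]) (by linarith)
      hb.slack_lam hb.slack_mu (by linarith) hs hsH hq
  have hQ : ∀ s, 0 ≤ s → s ≤ H → queueLength ρ x y T s 1 + queueLength ρ x y T s 2 ≤
      2 * (2 * κ + 1) + 1 + 4 * (totalDev x y N + 1) + 1 + d * H := fun s hs hsH =>
    h.queueLength_one_add_two_le hstarve (hxnear 1) (hynear 2) hb.drift_nonneg hb.drift_two hs hsH
  have htd := totalDev_nonneg x y N
  have hdH : 0 ≤ d * H := mul_nonneg hb.drift_nonneg hH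
  have hthr := h.thresholds
  have key : ∀ (b : ℝ) (j : Fin 3), 0 ≤ b → b / ρ.mu j ≤ Λ * b := fun b j hb0 => by
    rw [div_eq_mul_one_div, mul_comm]
    exact mul_le_mul_of_nonneg_right (hb.mu_inv_le j) hb0
  have h0 := h.workload_zero_le hQ hxnear hynear hb.drift_nonneg hb.drift_one ht htH
  have h1 := div_le_div_of_nonneg_right (hQ t ht htH) (hb.mu_pos 2).le
  rw [← workload_apply_one ρ (queueLength ρ x y T t)] at h1
  have hΔ : 0 ≤ logThreshold (c * l₀) n - logThreshold l₀ n := by linarith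
  generalize logThreshold (c * l₀) n - logThreshold l₀ n = Δ at *
  have k0 := key (Δ + 2) 1 (by linarith)
  have kQ := fun j => key (2 * (2 * κ + 1) + 1 + 4 * (totalDev x y N + 1) + 1 + d * H) j
    (by linarith)
  have kd : 4 * (totalDev x y N + 1) * (1 / ρ.mu 0 + 1 / ρ.mu 1) ≤
      4 * (totalDev x y N + 1) * (Λ + Λ) :=
    mul_le_mul_of_nonneg_left (add_le_add (hb.mu_inv_le 0) (hb.mu_inv_le 1)) (by linarith)
  have p1 := mul_nonneg (by linarith : 0 ≤ Λ) htd
  have p2 := mul_nonneg (by linarith : 0 ≤ Λ) hκ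
  have p3 := mul_nonneg (by linarith : 0 ≤ Λ) hΔ
  have p4 : d * H ≤ Λ * (d * H) := le_mul_of_one_le_left hdH hΛ
  fin_cases i
  · simp only [Fin.zero_eta]
    linarith [kQ 1]
  · simp only [Fin.mk_one]
    linarith [kQ 2]

theorem PathData.workload_le_arrivals (h : PathData ρ n c l₀ g₀ Ψ x y T)
    (hb : ρ.Bounds Λ ε d) {t : ℝ} (ht : 0 ≤ t) (htH : t ≤ H) (i : Fin 2) :
    workload ρ (queueLength ρ x y T t) i ≤ Λ * ((renewalCount (ρ.lam 0) (x 0) H : ℝ) +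
      renewalCount (ρ.lam 1) (x 1) H) := by
  obtain ⟨h0, h1⟩ := h.queueLength_le_arrivals ht htH
  have hq := h.queueLength_nonneg ht
  have key : ∀ (a b : ℝ) (j : Fin 3), 0 ≤ b → a ≤ b → a / ρ.mu j ≤ Λ * b := fun a b j hb0 hab => by
    rw [div_eq_mul_one_div, mul_comm]
    have hj := one_div_pos.2 (hb.mu_pos j)
    exact (mul_le_mul_of_nonneg_left hab hj.le).trans
      (mul_le_mul_of_nonneg_right (hb.mu_inv_le j) hb0)
  have hR0 : (0 : ℝ) ≤ renewalCount (ρ.lam 0) (x 0) H := Nat.cast_nonneg _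
  have hR1 : (0 : ℝ) ≤ renewalCount (ρ.lam 1) (x 1) H := Nat.cast_nonneg _
  fin_cases i
  · have e0 := key _ _ 0 hR0 h0
    have e1 := key (queueLength ρ x y T t 1) _ 1 hR1 (by linarith [hq 2])
    simp only [Fin.zero_eta, workload_apply_zero]
    linarith
  · have e1 := key _ _ 2 hR1 h1
    have e0 : 0 ≤ Λ * (renewalCount (ρ.lam 0) (x 0) H : ℝ) :=
      mul_nonneg (by linarith [hb.one_le]) hR0
    simp only [Fin.mk_one, workload_apply_one]
    linarith

open Classical in
/-- Bound on the squared workload, uniformly on `[0, H]`. -/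
theorem PathData.exists_bound (h : PathData ρ n c l₀ g₀ Ψ x y T)
    (hb : ρ.Bounds Λ ε d) (hκ : 0 ≤ κ) (hH : 0 ≤ H) (hN : 2 * (Λ * H + κ) < N)
    (hL : 4 * κ + 3 < logThreshold l₀ n) (i : Fin 2) :
    ∃ B : ℝ≥0∞, (∀ t, 0 ≤ t → t ≤ H →
      ENNReal.ofReal (workload ρ (queueLength ρ x y T t) i) ≤ B) ∧
      B ^ 2 ≤ ENNReal.ofReal (2048 * Λ ^ 2) * (ENNReal.ofReal (totalDev x y N ^ 2) +
        (ENNReal.ofReal ((κ + (logThreshold (c * l₀) n - logThreshold l₀ n) + 1 + d * H) ^ 2) +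
        (slowSum (x 0) + (slowSum (x 1) +
        if AllRegular x y ε κ N then 0 else 2 * (N : ℝ≥0∞) ^ 2)))) := by
  have hΛ := hb.one_le
  by_cases hreg : AllRegular x y ε κ N
  · set E := κ + (logThreshold (c * l₀) n - logThreshold l₀ n) + 1 + d * H with hE
    refine ⟨ENNReal.ofReal (32 * Λ * (totalDev x y N + E)), fun t ht htH => ?_, ?_⟩
    · exact ENNReal.ofReal_le_ofReal
        (h.workload_le_of_allRegular hb hκ hH hN hreg hL ht htH i)
    · have hE0 : 0 ≤ E := by
        have := h.thresholds
        have := mul_nonneg hb.drift_nonneg hH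
        linarith
      have htd := totalDev_nonneg x y N
      -- Here `2048 = 2 * 32²`, from `(a + b)² ≤ 2 (a² + b²)`.
      have h1 : ENNReal.ofReal (32 * Λ * (totalDev x y N + E)) ^ 2 ≤
          ENNReal.ofReal (2048 * Λ ^ 2) * (ENNReal.ofReal (totalDev x y N ^ 2) +
            ENNReal.ofReal (E ^ 2)) := by
        rw [← ENNReal.ofReal_pow (by positivity), ← ENNReal.ofReal_add (sq_nonneg _) (sq_nonneg _),
          ← ENNReal.ofReal_mul (by positivity)]
        refine ENNReal.ofReal_le_ofReal ?_
        have := mul_le_mul_of_nonneg_left (add_sq_le (a := totalDev x y N) (b := E))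
          (by positivity : 0 ≤ (32 * Λ) ^ 2)
        rw [mul_pow]
        linarith
      refine h1.trans ?_
      gcongr
      exact le_self_add
  · rw [if_neg hreg]
    refine ⟨ENNReal.ofReal (Λ * ((renewalCount (ρ.lam 0) (x 0) H : ℝ) +
      renewalCount (ρ.lam 1) (x 1) H)), fun t ht htH => ?_, ?_⟩
    · exact ENNReal.ofReal_le_ofReal (h.workload_le_arrivals hb ht htH i)
    · have hNk : ∀ k, 2 * (ρ.lam k * H) ≤ N := fun k => by
        have := mul_le_mul_of_nonneg_right (hb.lam_le k) hH
        linarith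
      have h0 := (h.path_x 0).renewalCount_sq_le (hb.lam_pos 0) hH (hNk 0)
      have h1 := (h.path_x 1).renewalCount_sq_le (hb.lam_pos 1) hH (hNk 1)
      set a := renewalCount (ρ.lam 0) (x 0) H
      set b := renewalCount (ρ.lam 1) (x 1) H
      have h2 : ENNReal.ofReal (Λ * ((a : ℝ) + b)) ^ 2 ≤
          ENNReal.ofReal (2048 * Λ ^ 2) * ((a : ℝ≥0∞) ^ 2 + (b : ℝ≥0∞) ^ 2) := by
        rw [← ENNReal.ofReal_pow (by positivity), ← ENNReal.ofReal_natCast a,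
          ← ENNReal.ofReal_natCast b, ← ENNReal.ofReal_pow (by positivity),
          ← ENNReal.ofReal_pow (by positivity), ← ENNReal.ofReal_add (by positivity)
          (by positivity), ← ENNReal.ofReal_mul (by positivity)]
        refine ENNReal.ofReal_le_ofReal ?_
        have := mul_le_mul_of_nonneg_left (add_sq_le (a := (a : ℝ)) (b := b))
          (by positivity : 0 ≤ Λ ^ 2)
        have h4 : 0 ≤ Λ ^ 2 * ((a : ℝ) ^ 2 + (b : ℝ) ^ 2) := by positivity
        rw [mul_pow]
        linarith
      refine h2.trans ?_
      refine mul_le_mul_right ((add_le_add h0 h1).trans ?_) _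
      calc (N : ℝ≥0∞) ^ 2 + slowSum (x 0) + ((N : ℝ≥0∞) ^ 2 + slowSum (x 1))
          = slowSum (x 0) + (slowSum (x 1) + 2 * (N : ℝ≥0∞) ^ 2) := by ring
        _ ≤ _ := le_add_self.trans le_add_self

end Path

end Crisscross

namespace Crisscross

/-! ### Second moments of the scaled workloads -/

theorem measurable_slowSum : Measurable slowSum :=
  Measurable.tsum fun _ => measurable_const.indicator <|
    measurableSet_le (Finset.measurable_sum _ fun i _ => measurable_pi_apply i) measurable_const

theorem measurable_maxDev (N : ℕ) : Measurable fun x : ℕ → ℝ => maxDev x N :=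
  ((measurable_runMax N).comp (measurable_pi_lambda _ fun i => (measurable_pi_apply i).sub_const 1)).add
    ((measurable_runMax N).comp
      (measurable_pi_lambda _ fun i => ((measurable_pi_apply i).sub_const 1).neg))

section Probability

variable {Ω : Type*} [MeasurableSpace Ω] {P : Measure Ω}
  {u : Fin 2 → ℕ → Ω → ℝ} {v : Fin 3 → ℕ → Ω → ℝ}

/-- Quantitative information on the five primitive sequences. -/
structure PrimitiveBounds (P : Measure Ω) (u : Fin 2 → ℕ → Ω → ℝ) (v : Fin 3 → ℕ → Ω → ℝ)
    (ε θ V : ℝ) : Prop where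
  renewal_u : ∀ k, IsRenewalSequence P (u k)
  renewal_v : ∀ j, IsRenewalSequence P (v j)
  chernoff_u : ∀ k, ChernoffExponent P (u k) ε θ
  chernoff_v : ∀ j, ChernoffExponent P (v j) ε θ
  nonneg : 0 ≤ V
  maxDev_u : ∀ k N, ∫⁻ ω, ENNReal.ofReal (maxDev (fun i => u k i ω) N ^ 2) ∂P ≤
    ENNReal.ofReal (V * N)
  maxDev_v : ∀ j N, ∫⁻ ω, ENNReal.ofReal (maxDev (fun i => v j i ω) N ^ 2) ∂P ≤
    ENNReal.ofReal (V * N)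

namespace PrimitiveBounds

variable {ε θ V κ : ℝ}

theorem lintegral_totalDev_sq_le (h : PrimitiveBounds P u v ε θ V) (N : ℕ) :
    ∫⁻ ω, ENNReal.ofReal (totalDev (fun k i => u k i ω) (fun j i => v j i ω) N ^ 2) ∂P ≤
      ENNReal.ofReal (25 * V * N) := by
  have hV := h.nonneg
  have hmu : ∀ k, Measurable fun ω => ENNReal.ofReal (maxDev (fun i => u k i ω) N ^ 2) := fun k =>
    (((measurable_maxDev N).comp
      (measurable_pi_lambda _ (h.renewal_u k).meas)).pow_const 2).ennreal_ofReal
  have hmv : ∀ j, Measurable fun ω => ENNReal.ofReal (maxDev (fun i => v j i ω) N ^ 2) := fun j =>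
    (((measurable_maxDev N).comp
      (measurable_pi_lambda _ (h.renewal_v j).meas)).pow_const 2).ennreal_ofReal
  calc ∫⁻ ω, ENNReal.ofReal (totalDev (fun k i => u k i ω) (fun j i => v j i ω) N ^ 2) ∂P
      ≤ ∫⁻ ω, ENNReal.ofReal 5 * (∑ k, ENNReal.ofReal (maxDev (fun i => u k i ω) N ^ 2) +
          ∑ j, ENNReal.ofReal (maxDev (fun i => v j i ω) N ^ 2)) ∂P := by
        refine lintegral_mono fun ω => ?_
        rw [← ENNReal.ofReal_sum_of_nonneg fun _ _ => sq_nonneg _,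
          ← ENNReal.ofReal_sum_of_nonneg fun _ _ => sq_nonneg _,
          ← ENNReal.ofReal_add (Finset.sum_nonneg fun _ _ => sq_nonneg _)
            (Finset.sum_nonneg fun _ _ => sq_nonneg _), ← ENNReal.ofReal_mul (by norm_num)]
        exact ENNReal.ofReal_le_ofReal (totalDev_sq_le _ _ N)
    _ = ENNReal.ofReal 5 * (∑ k, ∫⁻ ω, ENNReal.ofReal (maxDev (fun i => u k i ω) N ^ 2) ∂P +
          ∑ j, ∫⁻ ω, ENNReal.ofReal (maxDev (fun i => v j i ω) N ^ 2) ∂P) := by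
        rw [lintegral_const_mul' _ _ (by simp),
          lintegral_add_left (Finset.measurable_sum _ fun k _ => hmu k),
          lintegral_finsetSum _ fun k _ => hmu k, lintegral_finsetSum _ fun j _ => hmv j]
    _ ≤ ENNReal.ofReal 5 * (∑ _k : Fin 2, ENNReal.ofReal (V * N) +
          ∑ _j : Fin 3, ENNReal.ofReal (V * N)) := by
        gcongr with k _ j _
        · exact h.maxDev_u k N
        · exact h.maxDev_v j N
    _ = _ := by
        rw [← ENNReal.ofReal_sum_of_nonneg fun _ _ => by positivity,
          ← ENNReal.ofReal_sum_of_nonneg fun _ _ => by positivity,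
          ← ENNReal.ofReal_add (by positivity) (by positivity), ← ENNReal.ofReal_mul (by norm_num)]
        congr 1
        simp only [Finset.sum_const, Finset.card_univ, Fintype.card_fin, nsmul_eq_mul]
        push_cast
        ring

theorem measure_not_allRegular_le (h : PrimitiveBounds P u v ε θ V) (κ : ℝ) (N : ℕ) :
    P {ω | ¬ AllRegular (fun k i => u k i ω) (fun j i => v j i ω) ε κ N} ≤
      ENNReal.ofReal (10 * ((N : ℝ) + 1) ^ 2 * Real.exp (-θ * κ)) := by
  have hsub : {ω | ¬ AllRegular (fun k i => u k i ω) (fun j i => v j i ω) ε κ N} ⊆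
      (⋃ k, {ω | ¬ BlockRegular (fun i => u k i ω) ε κ N}) ∪
        ⋃ j, {ω | ¬ BlockRegular (fun i => v j i ω) ε κ N} := by
    intro ω hω
    rw [Set.mem_ofPred_eq, AllRegular, not_and_or, not_forall, not_forall] at hω
    rcases hω with ⟨k, hk⟩ | ⟨j, hj⟩
    · exact Or.inl (mem_iUnion.2 ⟨k, hk⟩)
    · exact Or.inr (mem_iUnion.2 ⟨j, hj⟩)
  refine (measure_mono hsub).trans ((measure_union_le _ _).trans ?_)
  refine (add_le_add (measure_iUnion_fintype_le _ _) (measure_iUnion_fintype_le _ _)).trans ?_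
  refine (add_le_add
    (Finset.sum_le_sum fun k _ => (h.chernoff_u k).measure_not_blockRegular_le κ N)
    (Finset.sum_le_sum fun j _ => (h.chernoff_v j).measure_not_blockRegular_le κ N)).trans ?_
  rw [← ENNReal.ofReal_sum_of_nonneg fun _ _ => by positivity,
    ← ENNReal.ofReal_sum_of_nonneg fun _ _ => by positivity,
    ← ENNReal.ofReal_add (by positivity) (by positivity)]
  refine ENNReal.ofReal_le_ofReal (le_of_eq ?_)
  simp only [Finset.sum_const, Finset.card_univ, Fintype.card_fin, nsmul_eq_mul]
  push_cast
  ring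

-- The pathwise bound is integrated term by term; diffusion scaling contributes the factor `1 / n`.
-- Only upper bounds on integrals are used, so neither the running supremum nor the exceptional
-- event needs to be measurable.
open Classical in
theorem supSecondMoment_le [IsProbabilityMeasure P] (h : PrimitiveBounds P u v ε θ V) {ρ : Rates} {n : ℕ}
    {c l₀ g₀ Λ d κ t : ℝ} {Ψ : ℝ → ℝ} {T : Ω → ℝ → Fin 3 → ℝ} {N : ℕ}
    (hpath : ∀ᵐ ω ∂P, PathData ρ n c l₀ g₀ Ψ (fun k i => u k i ω) (fun j i => v j i ω) (T ω))
    (hb : ρ.Bounds Λ ε d) (hκ : 0 ≤ κ) (ht : 0 ≤ t)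
    (hN : 2 * (Λ * (n * t) + κ) < N) (hL : 4 * κ + 3 < logThreshold l₀ n) (i : Fin 2) :
    supSecondMoment P (fun t ω => scaledWorkload ρ n (fun k i => u k i ω)
        (fun j i => v j i ω) (T ω) t i) t ≤
      ENNReal.ofReal (1 / n) * (ENNReal.ofReal (2048 * Λ ^ 2) * (ENNReal.ofReal (25 * V * N) +
        (ENNReal.ofReal
          ((κ + (logThreshold (c * l₀) n - logThreshold l₀ n) + 1 + d * (n * t)) ^ 2) +
        (∫⁻ ω, slowSum (fun i => u 0 i ω) ∂P + (∫⁻ ω, slowSum (fun i => u 1 i ω) ∂P +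
        2 * (N : ℝ≥0∞) ^ 2 *
          ENNReal.ofReal (10 * ((N : ℝ) + 1) ^ 2 * Real.exp (-θ * κ))))))) := by
  have hnt : (0 : ℝ) ≤ n * t := by positivity
  set E := κ + (logThreshold (c * l₀) n - logThreshold l₀ n) + 1 + d * (n * t) with hE
  set bad := {ω | ¬ AllRegular (fun k i => u k i ω) (fun j i => v j i ω) ε κ N} with hbad
  have hpt : ∀ᵐ ω ∂P, (⨆ s ∈ Icc (0 : ℝ) t, ENNReal.ofReal (scaledWorkload ρ n (fun k i => u k i ω)
      (fun j i => v j i ω) (T ω) s i)) ^ 2 ≤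
      ENNReal.ofReal (1 / n) * (ENNReal.ofReal (2048 * Λ ^ 2) *
        (ENNReal.ofReal (totalDev (fun k i => u k i ω) (fun j i => v j i ω) N ^ 2) +
        (ENNReal.ofReal (E ^ 2) + (slowSum (fun i => u 0 i ω) + (slowSum (fun i => u 1 i ω) +
        bad.indicator (fun _ => 2 * (N : ℝ≥0∞) ^ 2) ω))))) := by
    filter_upwards [hpath] with ω hω
    obtain ⟨B, hB, hB2⟩ := hω.exists_bound hb hκ hnt hN hL i
    have h1 : ⨆ s ∈ Icc (0 : ℝ) t, ENNReal.ofReal (scaledWorkload ρ n (fun k i => u k i ω)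
        (fun j i => v j i ω) (T ω) s i) ≤ ENNReal.ofReal ((√(n : ℝ))⁻¹) * B := by
      refine iSup₂_le fun s hs => ?_
      rw [scaledWorkload, Pi.smul_apply, smul_eq_mul,
        ENNReal.ofReal_mul (inv_nonneg.2 (Real.sqrt_nonneg _))]
      gcongr
      exact hB _ (mul_nonneg (Nat.cast_nonneg n) hs.1)
        (mul_le_mul_of_nonneg_left hs.2 (Nat.cast_nonneg n))
    refine (pow_le_pow_left' h1 2).trans ?_
    rw [mul_pow, ← ENNReal.ofReal_pow (inv_nonneg.2 (Real.sqrt_nonneg _)), inv_pow,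
      Real.sq_sqrt (Nat.cast_nonneg n), ← one_div]
    refine mul_le_mul_right (hB2.trans (le_of_eq ?_)) _
    by_cases hreg : AllRegular (fun k i => u k i ω) (fun j i => v j i ω) ε κ N
    · rw [if_pos hreg, indicator_of_notMem (by simpa [hbad] using hreg)]
    · rw [if_neg hreg, indicator_of_mem (by simpa [hbad] using hreg)]
  have hms : ∀ k, Measurable fun ω => slowSum fun i => u k i ω := fun k =>
    measurable_slowSum.comp (measurable_pi_lambda _ (h.renewal_u k).meas)
  have hmd : Measurable fun ω => ENNReal.ofReal
      (totalDev (fun k i => u k i ω) (fun j i => v j i ω) N ^ 2) := by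
    refine (Measurable.pow_const (Measurable.add ?_ ?_) 2).ennreal_ofReal
    · exact Finset.measurable_sum _ fun k _ => (measurable_maxDev N).comp
        (measurable_pi_lambda _ (h.renewal_u k).meas)
    · exact Finset.measurable_sum _ fun j _ => (measurable_maxDev N).comp
        (measurable_pi_lambda _ (h.renewal_v j).meas)
  refine (lintegral_mono_ae hpt).trans ?_
  rw [lintegral_const_mul' _ _ ENNReal.ofReal_ne_top, lintegral_const_mul' _ _ ENNReal.ofReal_ne_top,
    lintegral_add_left hmd, lintegral_add_left measurable_const, lintegral_add_left (hms 0),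
    lintegral_add_left (hms 1), lintegral_const, measure_univ, mul_one]
  gcongr
  · exact h.lintegral_totalDev_sq_le N
  · refine (lintegral_indicator_const_le _ _).trans ?_
    gcongr
    exact h.measure_not_allRegular_le κ N

end PrimitiveBounds

end Probability

/-! ### Growth of the bound -/

theorem logThreshold_le (a : ℝ) (n : ℕ) : logThreshold a n ≤ a * Real.log n := Int.floor_le _

theorem lt_logThreshold (a : ℝ) (n : ℕ) : a * Real.log n - 1 < logThreshold a n :=
  Int.sub_one_lt_floor _

theorem log_le_two_mul_sqrt {a : ℝ} (ha : 0 < a) : Real.log a ≤ 2 * √a := by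
  have h1 := Real.log_le_sub_one_of_pos (Real.sqrt_pos.2 ha)
  rw [Real.log_sqrt ha.le] at h1
  linarith

/-- With logarithmic `κ`, the bound on the second moments is polynomial in `t`, uniformly in
`n`. -/
theorem secondMoment_bound_le {Λ V K θ l₀ c D z t : ℝ} {n : ℕ} (hn : 1 ≤ n) (hΛ : 1 ≤ Λ)
    (hV : 0 ≤ V) (hK : 0 ≤ K) (hθ : θ * K = 4) (hl₀ : 0 ≤ l₀) (hc : 1 ≤ c) (hD : 0 ≤ D)
    (hz : 0 ≤ z) (ht : 0 ≤ t) (hthr : logThreshold l₀ n ≤ logThreshold (c * l₀) n) {N : ℕ}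
    (hN : (N : ℝ) ≤ 2 * (Λ * (n * t) + K * Real.log n) + 2) :
    1 / (n : ℝ) * (2048 * Λ ^ 2 * (25 * V * N +
      ((K * Real.log n + (logThreshold (c * l₀) n - logThreshold l₀ n) + 1 +
        D / √n * (n * t)) ^ 2 +
      (z + 2 * (N : ℝ) ^ 2 * (10 * ((N : ℝ) + 1) ^ 2 * Real.exp (-θ * (K * Real.log n))))))) ≤
    2048 * Λ ^ 2 * (25 * V * (2 * Λ + 2 * K + 3) + (2 * K + 2 * (c - 1) * l₀ + 2 + D) ^ 2 + z +
      20 * (2 * Λ + 2 * K + 3) ^ 4) * (1 + t) ^ 4 := by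
  have hn' : (1 : ℝ) ≤ n := by exact_mod_cast hn
  have hn0 : (0 : ℝ) < n := by linarith
  have hlog0 : 0 ≤ Real.log n := Real.log_nonneg hn'
  have hlogn : Real.log n ≤ n := (Real.log_le_sub_one_of_pos hn0).trans (by linarith)
  have hlogs := log_le_two_mul_sqrt hn0
  have hs1 : 1 ≤ √(n : ℝ) := Real.one_le_sqrt.2 hn'
  have hss : √(n : ℝ) * √n = n := Real.mul_self_sqrt hn0.le
  set C₀ := 2 * Λ + 2 * K + 3 with hC₀
  set E₀ := 2 * K + 2 * (c - 1) * l₀ + 2 + D with hE₀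
  have hcl : 0 ≤ (c - 1) * l₀ := mul_nonneg (by linarith) hl₀
  have hC₀0 : 0 ≤ C₀ := by positivity
  have hE₀0 : 0 ≤ E₀ := by
    rw [hE₀]
    nlinarith
  have hN1 : (N : ℝ) + 1 ≤ C₀ * n * (1 + t) := by
    have h1 : K * Real.log n ≤ K * n := mul_le_mul_of_nonneg_left hlogn hK
    have h2 : 0 ≤ Λ * (n : ℝ) := by positivity
    have h3 : 0 ≤ K * (n * t) := by positivity
    have h4 : 0 ≤ (n : ℝ) * t := by positivity
    rw [hC₀]
    nlinarith
  -- The choice `θ K = 4` compensates exactly the factor `n⁴` in `N² (N + 1)²`: two powers come from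
  -- the squared count and two from the union bound.
  have hexp : Real.exp (-θ * (K * Real.log n)) * (n : ℝ) ^ 4 = 1 := by
    rw [show -θ * (K * Real.log n) = -(((4 : ℕ) : ℝ) * Real.log n) by push_cast; rw [← hθ]; ring,
      Real.exp_neg, Real.exp_nat_mul, Real.exp_log hn0]
    field_simp
  have hE : K * Real.log n + (logThreshold (c * l₀) n - logThreshold l₀ n) + 1 +
      D / √n * (n * t) ≤ √n * (E₀ * (1 + t)) := by
    have h1 : K * Real.log n ≤ K * (2 * √n) := mul_le_mul_of_nonneg_left hlogs hK
    have h2 := logThreshold_le (c * l₀) n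
    have h3 := lt_logThreshold l₀ n
    have h4 : (c - 1) * l₀ * Real.log n ≤ (c - 1) * l₀ * (2 * √n) :=
      mul_le_mul_of_nonneg_left hlogs hcl
    -- A drift of order `n^{-1/2}` over a horizon `n t` is of the same order `√n` as the
    -- fluctuations, so it survives the scaling as a constant.
    have h5 : D / √n * (n * t) = √n * (D * t) := by
      have hs0 : √(n : ℝ) ≠ 0 := by positivity
      calc D / √n * (n * t) = D / √n * (√n * √n * t) := by rw [hss]
        _ = √n * (D * t) := by field_simp
    have h6 : 0 ≤ √(n : ℝ) * ((2 * K + 2 * ((c - 1) * l₀) + 2) * t + D) := by positivity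
    rw [h5, hE₀]
    linarith
  have hEnn : 0 ≤ K * Real.log n + (logThreshold (c * l₀) n - logThreshold l₀ n) + 1 +
      D / √n * (n * t) := by
    have h1 : 0 ≤ K * Real.log n := by positivity
    have h2 : 0 ≤ D / √(n : ℝ) * (n * t) := by positivity
    linarith
  have hE2 := pow_le_pow_left₀ hEnn hE 2
  rw [mul_pow, sq (√(n : ℝ)), hss, mul_pow] at hE2
  have hN0 : (0 : ℝ) ≤ N := Nat.cast_nonneg _
  have hbad : 2 * (N : ℝ) ^ 2 * (10 * ((N : ℝ) + 1) ^ 2 * Real.exp (-θ * (K * Real.log n))) ≤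
      20 * C₀ ^ 4 * (1 + t) ^ 4 := by
    have h1 : (N : ℝ) ^ 2 * ((N : ℝ) + 1) ^ 2 ≤ (C₀ * n * (1 + t)) ^ 2 * (C₀ * n * (1 + t)) ^ 2 := by
      gcongr
      linarith
    have h2 := mul_le_mul_of_nonneg_right h1 (Real.exp_pos (-θ * (K * Real.log n))).le
    have h3 : (C₀ * n * (1 + t)) ^ 2 * (C₀ * n * (1 + t)) ^ 2 *
        Real.exp (-θ * (K * Real.log n)) = C₀ ^ 4 * (1 + t) ^ 4 *
        (Real.exp (-θ * (K * Real.log n)) * (n : ℝ) ^ 4) := by ring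
    rw [h3, hexp] at h2
    linarith
  have ht1 : 1 ≤ 1 + t := by linarith
  have hp : ∀ k ≤ 4, (1 + t) ^ k ≤ (1 + t) ^ 4 := fun k hk => pow_le_pow_right₀ ht1 hk
  have hq1 := hp 1 (by norm_num)
  have hq2 := hp 2 (by norm_num)
  have hq0 := hp 0 (by norm_num)
  rw [pow_one] at hq1
  rw [pow_zero] at hq0
  have hnt : (1 + t) ^ 4 ≤ n * (1 + t) ^ 4 := le_mul_of_one_le_left (by positivity) hn'
  have t1 : 25 * V * N ≤ n * (25 * V * C₀ * (1 + t) ^ 4) := by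
    have h1 : (N : ℝ) ≤ C₀ * n * (1 + t) ^ 4 :=
      (by linarith : (N : ℝ) ≤ C₀ * n * (1 + t)).trans
        (mul_le_mul_of_nonneg_left hq1 (by positivity))
    have := mul_le_mul_of_nonneg_left h1 (by positivity : 0 ≤ 25 * V)
    linarith
  have t2 := hE2.trans (mul_le_mul_of_nonneg_left
    (mul_le_mul_of_nonneg_left hq2 (sq_nonneg E₀)) hn0.le)
  have t3 : z ≤ n * (z * (1 + t) ^ 4) := by
    have := mul_le_mul_of_nonneg_left (hq0.trans hnt) hz
    linarith
  have t4 := hbad.trans (by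
    have := mul_le_mul_of_nonneg_left hnt (by positivity : 0 ≤ 20 * C₀ ^ 4)
    linarith : 20 * C₀ ^ 4 * (1 + t) ^ 4 ≤ n * (20 * C₀ ^ 4 * (1 + t) ^ 4))
  rw [one_div, inv_mul_le_iff₀ hn0]
  have hfin := mul_le_mul_of_nonneg_left (add_le_add t1 (add_le_add t2 (add_le_add t3 t4)))
    (by positivity : 0 ≤ 2048 * Λ ^ 2)
  refine hfin.trans (le_of_eq ?_)
  ring

/-! ### Discounting -/

/-- The discounted tail of a quartic polynomial. -/
noncomputable def quarticTail (C γ t₀ : ℝ) : ℝ≥0∞ :=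
  ∫⁻ t in Ici t₀, ENNReal.ofReal (Real.exp (-γ * t)) * ENNReal.ofReal (C * (1 + t) ^ 4)

/-- Half of the discount, through the fourth term of the exponential series, absorbs the quartic;
the other half remains integrable. -/
theorem quarticTail_zero_lt_top {C γ : ℝ} (hC : 0 ≤ C) (hγ : 0 < γ) : quarticTail C γ 0 < ⊤ := by
  set A := C * (24 * (2 / γ) ^ 4 * Real.exp (γ / 2)) with hA
  have hA0 : 0 ≤ A := by positivity
  have hint : IntegrableOn (fun t => A * Real.exp (-(γ / 2) * t)) (Ici 0) := by
    rw [integrableOn_Ici_iff_integrableOn_Ioi]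
    exact (exp_neg_integrableOn_Ioi 0 (by positivity)).const_mul A
  refine lt_of_le_of_lt ?_ hint.lintegral_lt_top
  refine setLIntegral_mono' measurableSet_Ici fun t ht => ?_
  have ht0 : (0 : ℝ) ≤ t := ht
  rw [← ENNReal.ofReal_mul (Real.exp_pos _).le]
  refine ENNReal.ofReal_le_ofReal ?_
  have h1 := Real.pow_div_factorial_le_exp (γ / 2 * (1 + t)) (by positivity) 4
  have h2 : (1 + t) ^ 4 ≤ 24 * (2 / γ) ^ 4 * Real.exp (γ / 2 * (1 + t)) := by
    have h3 : (1 + t) ^ 4 = 24 * (2 / γ) ^ 4 * ((γ / 2 * (1 + t)) ^ 4 / (Nat.factorial 4 : ℝ)) := by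
      rw [show (Nat.factorial 4 : ℝ) = 24 by norm_num [Nat.factorial]]
      field_simp
    rw [h3]
    exact mul_le_mul_of_nonneg_left h1 (by positivity)
  calc Real.exp (-γ * t) * (C * (1 + t) ^ 4)
      ≤ Real.exp (-γ * t) * (C * (24 * (2 / γ) ^ 4 * Real.exp (γ / 2 * (1 + t)))) := by gcongr
    _ = A * (Real.exp (-γ * t) * Real.exp (γ / 2 * t)) := by
        rw [hA, mul_add, mul_one, Real.exp_add]
        ring
    _ = A * Real.exp (-(γ / 2) * t) := by
        rw [← Real.exp_add]
        ring_nf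

/-- Continuity from above, along half-lines decreasing to the empty set, of the measure with this
density. -/
theorem tendsto_quarticTail {C γ : ℝ} (hC : 0 ≤ C) (hγ : 0 < γ) :
    Tendsto (quarticTail C γ) atTop (𝓝 0) := by
  set ν := (volume : Measure ℝ).withDensity fun t =>
    ENNReal.ofReal (Real.exp (-γ * t)) * ENNReal.ofReal (C * (1 + t) ^ 4) with hν
  have h1 : ∀ t₀, ν (Ici t₀) = quarticTail C γ t₀ := fun t₀ =>
    withDensity_apply _ measurableSet_Ici
  have h2 := tendsto_measure_iInter_atTop (μ := ν) (s := fun t : ℝ => Ici t)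
    (fun _ => measurableSet_Ici.nullMeasurableSet) antitone_Ici
    ⟨0, by rw [h1]; exact (quarticTail_zero_lt_top hC hγ).ne⟩
  have h3 : ⋂ t : ℝ, Ici t = ∅ := by
    refine eq_empty_of_forall_notMem fun a ha => ?_
    have : a + 1 ≤ a := mem_iInter.1 ha (a + 1)
    linarith
  rw [h3, measure_empty] at h2
  exact h2.congr h1

theorem discountedTail_le {Ω : Type*} [MeasurableSpace Ω] {P : Measure Ω} {γ C t₀ : ℝ}
    {Z : ℝ → Ω → ℝ} (ht₀ : 0 ≤ t₀)
    (h : ∀ t, 0 ≤ t → supSecondMoment P Z t ≤ ENNReal.ofReal (C * (1 + t) ^ 4)) :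
    discountedTail P γ Z t₀ ≤ quarticTail C γ t₀ :=
  setLIntegral_mono' measurableSet_Ici fun t ht => mul_le_mul_right (h t (ht₀.trans ht)) _

end Crisscross

namespace Crisscross

/-! ### Constants from the heavy traffic and moment assumptions -/

namespace PrimitiveTimes

variable {Ω : Type*} [MeasurableSpace Ω] {P : Measure Ω} {r' : Rates}
  {u : Fin 2 → ℕ → Ω → ℝ} {v : Fin 3 → ℕ → Ω → ℝ}

theorem eventually_integrable_exp {O : Set ℝ} (hO : IsOpen O) (h0 : (0 : ℝ) ∈ O) {m : ℝ}
    (hm : 0 < m) {X : Ω → ℝ} (h : ∀ l ∈ O, Integrable (fun ω => Real.exp (l * X ω / m)) P) :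
    ∀ᶠ l in 𝓝 (0 : ℝ), Integrable (fun ω => Real.exp (l * X ω)) P := by
  have ht : Tendsto (fun l : ℝ => l * m) (𝓝 0) (𝓝 0) := by
    have := (continuous_mul_const m).tendsto (0 : ℝ)
    rwa [zero_mul] at this
  filter_upwards [ht.eventually (hO.mem_nhds h0)] with l hl
  have := h _ hl
  have heq : (fun ω => Real.exp (l * m * X ω / m)) = fun ω => Real.exp (l * X ω) := by
    funext ω
    congr 1
    field_simp
  rwa [heq] at this

theorem isRenewalSequence_u [IsProbabilityMeasure P] (h : PrimitiveTimes P r' u v) (hlam : ∀ k, 0 < r'.lam k) (k : Fin 2) :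
    IsRenewalSequence P (u k) where
  meas := h.measurable_u k
  pos := h.pos_u k
  centered := by
    obtain ⟨O, hO, h0, hint⟩ := h.mgf_finite
    refine isCenteredIID_sub_one (h.measurable_u k) (h.ident_u k) ?_ (h.mean_u k)
      (eventually_integrable_exp hO h0 (hlam k) fun l hl => (hint l hl).1 k)
    exact h.indep.precomp (g := fun i : ℕ => Sum.inl (k, i)) fun i j hij => by simpa using hij

theorem isRenewalSequence_v [IsProbabilityMeasure P] (h : PrimitiveTimes P r' u v) (hmu : ∀ j, 0 < r'.mu j) (j : Fin 3) :
    IsRenewalSequence P (v j) where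
  meas := h.measurable_v j
  pos := h.pos_v j
  centered := by
    obtain ⟨O, hO, h0, hint⟩ := h.mgf_finite
    refine isCenteredIID_sub_one (h.measurable_v j) (h.ident_v j) ?_ (h.mean_v j)
      (eventually_integrable_exp hO h0 (hmu j) fun l hl => (hint l hl).2 j)
    exact h.indep.precomp (g := fun i : ℕ => Sum.inr (j, i)) fun i k hik => by simpa using hik

/-- Every sufficiently small `θ > 0` is a Chernoff exponent for each sequence, so one `θ` serves all
five. -/
theorem exists_primitiveBounds [IsProbabilityMeasure P] (h : PrimitiveTimes P r' u v) (hlam : ∀ k, 0 < r'.lam k)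
    (hmu : ∀ j, 0 < r'.mu j) {ε : ℝ} (hε : 0 < ε) :
    ∃ θ V, 0 < θ ∧ PrimitiveBounds P u v ε θ V := by
  have hu := h.isRenewalSequence_u hlam
  have hv := h.isRenewalSequence_v hmu
  obtain ⟨θ, ⟨hθu, hθv⟩, hθ⟩ := (((eventually_all.2 fun k =>
    (hu k).eventually_chernoffExponent hε).and (eventually_all.2 fun j =>
    (hv j).eventually_chernoffExponent hε)).and self_mem_nhdsWithin).exists
  choose Vu hVu0 hVu using fun k => (hu k).exists_lintegral_maxDev_sq_le
  choose Vv hVv0 hVv using fun j => (hv j).exists_lintegral_maxDev_sq_le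
  have hsu : 0 ≤ ∑ k, Vu k := Finset.sum_nonneg fun k _ => hVu0 k
  have hsv : 0 ≤ ∑ j, Vv j := Finset.sum_nonneg fun j _ => hVv0 j
  refine ⟨θ, ∑ k, Vu k + ∑ j, Vv j, hθ, hu, hv, hθu, hθv, add_nonneg hsu hsv, fun k N => ?_,
    fun j N => ?_⟩
  · refine (hVu k N).trans (ENNReal.ofReal_le_ofReal ?_)
    have := Finset.single_le_sum (f := Vu) (fun k _ => hVu0 k) (Finset.mem_univ k)
    gcongr
    linarith
  · refine (hVv j N).trans (ENNReal.ofReal_le_ofReal ?_)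
    have := Finset.single_le_sum (f := Vv) (fun j _ => hVv0 j) (Finset.mem_univ j)
    gcongr
    linarith

end PrimitiveTimes

/-- Convergent functions of a finite index are eventually bounded. -/
theorem exists_eventually_le {ι : Type*} [Finite ι] {f : ℕ → ι → ℝ} {a : ι → ℝ}
    (h : ∀ i, Tendsto (fun n => f n i) atTop (𝓝 (a i))) :
    ∃ A : ℝ, ∀ᶠ n in atTop, ∀ i, f n i ≤ A := by
  cases nonempty_fintype ι
  refine ⟨∑ i, (|a i| + 1), eventually_all.2 fun i => ?_⟩
  filter_upwards [(h i).eventually_lt_const (lt_add_one (a i))] with n hn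
  have h1 := Finset.single_le_sum (f := fun i => |a i| + 1) (fun i _ => by positivity)
    (Finset.mem_univ i)
  have h2 := le_abs_self (a i)
  exact hn.le.trans ((add_le_add_left h2 1).trans h1)

theorem HeavyTraffic.exists_bounds {r : ℕ → Rates} {r' : Rates} {b : Fin 3 → ℝ}
    (h : HeavyTraffic r r' b) :
    ∃ Λ ε D, 1 ≤ Λ ∧ 0 < ε ∧ 0 ≤ D ∧ ∀ᶠ n : ℕ in atTop, (r n).Bounds Λ ε (D / √(n : ℝ)) := by
  have hμ0 := h.mu_lim_pos 0
  have hμ1 := h.mu_lim_pos 1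
  have hμ2 := h.mu_lim_pos 2
  -- Class 1 uses a positive share of Station 1, so `λ₂ < μ₂` strictly, and `μ₃ = λ₂`. This slack
  -- fixes `ε` and is what lets Server 1 refill Buffer 3.
  have hlam1 : r'.lam 1 < r'.mu 1 := by
    have h1 : 0 < r'.lam 0 / r'.mu 0 := div_pos (h.lam_lim_pos 0) hμ0
    have h2 : r'.lam 1 / r'.mu 1 < 1 := by linarith [h.critical_one]
    rwa [div_lt_one hμ1] at h2
  have hmu2 : r'.mu 2 < r'.mu 1 := by
    rw [← (div_eq_one_iff_eq hμ2.ne').1 h.critical_two]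
    exact hlam1
  have hslack : ∀ a : ℝ, a < r'.mu 1 →
      ∀ᶠ ε in 𝓝[>] (0 : ℝ), (1 + 2 * ε) * a < (1 - 2 * ε) * r'.mu 1 := fun a ha => by
    refine nhdsWithin_le_nhds (ContinuousAt.eventually_lt (by fun_prop) (by fun_prop) ?_)
    simpa using ha
  obtain ⟨ε, ⟨⟨hε1, hε2⟩, hε3⟩, hε0⟩ := (((hslack _ hlam1).and (hslack _ hmu2)).and
    (nhdsWithin_le_nhds (eventually_le_nhds (by norm_num : (0 : ℝ) < 1 / 4)))).and
    self_mem_nhdsWithin |>.exists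
  obtain ⟨Λ₁, hΛ₁⟩ := exists_eventually_le (f := fun n k => (r n).lam k) h.lam_tendsto
  obtain ⟨Λ₂, hΛ₂⟩ := exists_eventually_le (f := fun n k => (r n).mu k) h.mu_tendsto
  obtain ⟨Λ₃, hΛ₃⟩ := exists_eventually_le (f := fun n k => 1 / (r n).mu k)
    fun j => tendsto_const_nhds.div (h.mu_tendsto j) (h.mu_lim_pos j).ne'
  set Λ := 1 + |Λ₁| + |Λ₂| + |Λ₃| with hΛ
  have a1 := abs_nonneg Λ₁
  have a2 := abs_nonneg Λ₂
  have a3 := abs_nonneg Λ₃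
  have hΛ1 : 1 ≤ Λ := by linarith
  have hD2 : 0 ≤ Λ * (|b 2| + 1) := by positivity
  refine ⟨Λ, ε, Λ * (|b 2| + 1) + (|b 0| + |b 1| + 1), hΛ1, hε0, by positivity, ?_⟩
  have hsum := (h.tendsto_one.add h.tendsto_two).eventually_lt_const
    (u := |b 0| + |b 1| + 1) (by linarith [le_abs_self (b 0), le_abs_self (b 1)])
  have h3 := h.tendsto_three.eventually_lt_const
    (u := |b 2| + 1) (by linarith [le_abs_self (b 2)])
  have hs1 := ((h.lam_tendsto 1).const_mul (1 + 2 * ε)).eventually_lt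
    ((h.mu_tendsto 1).const_mul (1 - 2 * ε)) hε1
  have hs2 := ((h.mu_tendsto 2).const_mul (1 + 2 * ε)).eventually_lt
    ((h.mu_tendsto 1).const_mul (1 - 2 * ε)) hε2
  filter_upwards [hΛ₁, hΛ₂, hΛ₃, hsum, h3, hs1, hs2, eventually_ge_atTop 1]
    with n e1 e2 e3 esum eb2 es1 es2 hn
  have hsq : 0 < √(n : ℝ) := Real.sqrt_pos.2 (by exact_mod_cast hn)
  refine ⟨h.lam_pos n, h.mu_pos n, hΛ1, fun k => (e1 k).trans (by linarith [le_abs_self Λ₁]),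
    fun j => (e2 j).trans (by linarith [le_abs_self Λ₂]),
    fun j => (e3 j).trans (by linarith [le_abs_self Λ₃]), hε0, hε3, es1.le, es2.le,
    by positivity, ?_, ?_⟩
  · rw [le_div_iff₀ hsq]
    have hcrit : √(n : ℝ) * (r'.lam 0 / r'.mu 0 + r'.lam 1 / r'.mu 1) = √(n : ℝ) := by
      rw [h.critical_one, mul_one]
    linarith
  · rw [le_div_iff₀ hsq]
    have hm := h.mu_pos n 2
    have e4 : ((r n).lam 1 - (r n).mu 2) * √(n : ℝ) =
        (r n).mu 2 * (√(n : ℝ) * ((r n).lam 1 / (r n).mu 2 - 1)) := by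
      field_simp
    rw [e4]
    have e5 : (r n).mu 2 * (√(n : ℝ) * ((r n).lam 1 / (r n).mu 2 - 1)) ≤ Λ * (|b 2| + 1) :=
      (mul_le_mul_of_nonneg_left eb2.le hm.le).trans
        (mul_le_mul_of_nonneg_right ((e2 2).trans (by linarith [le_abs_self Λ₂])) (by positivity))
    have e6 : 0 ≤ |b 0| + |b 1| + 1 := by positivity
    linarith

/-- Uniform quartic bound on the second moments of the running maxima of the scaled workloads. -/
theorem exists_supSecondMoment_le {Ω : Type*} [MeasurableSpace Ω] (P : Measure Ω)
    [IsProbabilityMeasure P] {r : ℕ → Rates} {r' : Rates} {b : Fin 3 → ℝ}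
    {u : Fin 2 → ℕ → Ω → ℝ} {v : Fin 3 → ℕ → Ω → ℝ} (hr : HeavyTraffic r r' b)
    (huv : PrimitiveTimes P r' u v) {c : ℝ} (hc : 1 < c) :
    ∃ lbar : ℝ, 1 < lbar ∧ ∀ l₀ : ℝ, lbar ≤ l₀ → ∃ C : ℝ, 0 ≤ C ∧ ∀ (g₀ : ℝ) (Ψ : ℝ → ℝ)
      (T : ℕ → Ω → ℝ → Fin 3 → ℝ),
      (∀ᶠ n in atTop, ∀ᵐ ω ∂P, FollowsPolicy (r n) n c l₀ g₀ Ψ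
        (fun k i => u k i ω) (fun j i => v j i ω) (T n ω)) →
      ∀ᶠ n : ℕ in atTop, ∀ (i : Fin 2) (t : ℝ), 0 ≤ t →
        supSecondMoment P (fun t ω => scaledWorkload (r n) n (fun k i => u k i ω)
          (fun j i => v j i ω) (T n ω) t i) t ≤ ENNReal.ofReal (C * (1 + t) ^ 4) := by
  obtain ⟨Λ, ε, D, hΛ, hε, hD, hbounds⟩ := hr.exists_bounds
  obtain ⟨θ, V, hθ, hPB⟩ := huv.exists_primitiveBounds hr.lam_lim_pos hr.mu_lim_pos hε
  set K := 4 / θ with hKdef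
  have hK : 0 < K := by positivity
  have hθK : θ * K = 4 := by
    rw [hKdef]
    field_simp
  have hz : ∀ k, ∫⁻ ω, slowSum (fun i => u k i ω) ∂P ≠ ⊤ := fun k =>
    (hPB.renewal_u k).lintegral_slowSum_lt_top.ne
  set z := (∫⁻ ω, slowSum (fun i => u 0 i ω) ∂P).toReal +
    (∫⁻ ω, slowSum (fun i => u 1 i ω) ∂P).toReal with hzdef
  have hz0 : 0 ≤ z := by positivity
  -- The multiple `4K` makes `L` exceed `4κ`; the extra `2 log n` absorbs the constant `3` and the
  -- rounding in the threshold.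
  refine ⟨4 * K + 2, by linarith, fun l₀ hl₀ => ?_⟩
  have hl₀0 : 0 ≤ l₀ := by linarith
  have hV := hPB.nonneg
  refine ⟨2048 * Λ ^ 2 * (25 * V * (2 * Λ + 2 * K + 3) + (2 * K + 2 * (c - 1) * l₀ + 2 + D) ^ 2 +
    z + 20 * (2 * Λ + 2 * K + 3) ^ 4), by positivity, fun g₀ Ψ T hT => ?_⟩
  have hlog : Tendsto (fun n : ℕ => Real.log n) atTop atTop :=
    Real.tendsto_log_atTop.comp tendsto_natCast_atTop_atTop
  have hcl : 0 < (c - 1) * l₀ := mul_pos (by linarith) (by linarith)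
  filter_upwards [hT, hbounds, eventually_ge_atTop 1, hlog.eventually_ge_atTop 4,
    hlog.eventually_ge_atTop (2 / ((c - 1) * l₀))] with n hTn hbn hn hlog4 hlog2 i t ht
  have hthr : logThreshold l₀ n ≤ logThreshold (c * l₀) n - 1 := by
    have h1 := logThreshold_le l₀ n
    have h2 := lt_logThreshold (c * l₀) n
    rw [div_le_iff₀' hcl] at hlog2
    linarith
  have hpath : ∀ᵐ ω ∂P, PathData (r n) n c l₀ g₀ Ψ (fun k i => u k i ω) (fun j i => v j i ω)
      (T n ω) := by
    filter_upwards [hTn, ae_all_iff.2 fun k => (hPB.renewal_u k).ae_isRenewalPath,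
      ae_all_iff.2 fun j => (hPB.renewal_v j).ae_isRenewalPath] with ω h1 h2 h3
    exact ⟨⟨hbn.lam_pos, hbn.mu_pos⟩, h2, h3, h1, hthr⟩
  set κ := K * Real.log n with hκ
  have hκ0 : 0 ≤ κ := mul_nonneg hK.le (by linarith)
  have hL : 4 * κ + 3 < logThreshold l₀ n := by
    have h1 := lt_logThreshold l₀ n
    have h2 : (4 * K + 2) * Real.log n ≤ l₀ * Real.log n :=
      mul_le_mul_of_nonneg_right hl₀ (by linarith)
    linarith
  have hNb0 : 0 ≤ 2 * (Λ * (n * t) + κ) := by positivity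
  -- Least convenient range of indices that no renewal count reaches by time `n t` on the regular
  -- event.
  set N := ⌊2 * (Λ * (n * t) + κ)⌋₊ + 1 with hNdef
  have hN1 : 2 * (Λ * (n * t) + κ) < N := by
    rw [hNdef]
    push_cast
    exact Nat.lt_floor_add_one _
  have hN2 : (N : ℝ) ≤ 2 * (Λ * (n * t) + κ) + 2 := by
    have := Nat.floor_le hNb0
    rw [hNdef]
    push_cast
    linarith
  refine (hPB.supSecondMoment_le hpath hbn hκ0 ht hN1 hL i).trans ?_
  refine le_trans (le_of_eq ?_) (ENNReal.ofReal_le_ofReal (secondMoment_bound_le hn hΛ hV hK.le hθK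
    hl₀0 hc.le hD hz0 ht (by linarith) hN2))
  rw [← ENNReal.ofReal_toReal (hz 0), ← ENNReal.ofReal_toReal (hz 1),
    show (2 : ℝ≥0∞) * (N : ℝ≥0∞) ^ 2 = ENNReal.ofReal (2 * (N : ℝ) ^ 2) by
      rw [ENNReal.ofReal_mul (by norm_num), ENNReal.ofReal_pow (by positivity)]
      simp,
    ← ENNReal.ofReal_mul (by positivity), ← ENNReal.ofReal_add (by positivity) (by positivity),
    ← ENNReal.ofReal_add (by positivity) (by positivity),
    ← ENNReal.ofReal_add (by positivity) (by positivity),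
    ← ENNReal.ofReal_add (by positivity) (by positivity),
    ← ENNReal.ofReal_mul (by positivity), ← ENNReal.ofReal_mul (by positivity), hzdef]
  congr 1
  ring

end Crisscross

/-! ### Conclusion: discounting the uniform quartic bound. -/

theorem theorem5p9
    {Ω : Type*} [MeasurableSpace Ω] (P : Measure Ω) [IsProbabilityMeasure P]
    (r : ℕ → Crisscross.Rates) (r' : Crisscross.Rates) (b : Fin 3 → ℝ)
    (u : Fin 2 → ℕ → Ω → ℝ) (v : Fin 3 → ℕ → Ω → ℝ)
    (hr : Crisscross.HeavyTraffic r r' b)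
    (huv : Crisscross.PrimitiveTimes P r' u v)
    (c : ℝ) (hc : 1 < c) :
    ∃ lbar : ℝ, 1 < lbar ∧ ∀ l₀ : ℝ, lbar ≤ l₀ → ∀ g₀ : ℝ, 0 < g₀ →
      -- holding costs and discount factor
      ∀ (h : Fin 3 → ℝ) (γ : ℝ), (∀ j, 0 < h j) → 0 < γ →
      h 1 * r'.mu 1 - h 2 * r'.mu 1 < 0 → 0 ≤ h 1 * r'.mu 1 - h 0 * r'.mu 0 →
      -- the filtered probability space and the Brownian motion of the limiting control problem
      ∀ {Ω' : Type*} [mΩ' : MeasurableSpace Ω'] (P' : Measure Ω') [IsProbabilityMeasure P']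
        (ℱ : Filtration ℝ≥0 mΩ') (X : ℝ≥0 → Ω' → EuclideanSpace ℝ (Fin 3)),
      Crisscross.IsBrownianMotion P' ℱ (Crisscross.limitDrift r' b)
        (Crisscross.limitCov r' (fun k => variance (u k 0) P) (fun j => variance (v j 0) P)) X →
      -- the allocation processes of the policy
      ∀ T : ℕ → Ω → ℝ → Fin 3 → ℝ,
      (∀ᶠ n in atTop, ∀ᵐ ω ∂P, Crisscross.FollowsPolicy (r n) n c l₀ g₀
        (Crisscross.freeBoundary P' ℱ r' h γ X)
        (fun k i => u k i ω) (fun j i => v j i ω) (T n ω)) →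
      ∀ i : Fin 2,
        limsup (fun n : ℕ => Crisscross.discountedTail P γ
          (fun t ω => Crisscross.scaledWorkload (r n) n (fun k i => u k i ω)
            (fun j i => v j i ω) (T n ω) t i) 0) atTop < ⊤ ∧
        limsup (fun t₀ : ℝ => limsup (fun n : ℕ => Crisscross.discountedTail P γ
          (fun t ω => Crisscross.scaledWorkload (r n) n (fun k i => u k i ω)
            (fun j i => v j i ω) (T n ω) t i) t₀) atTop) atTop = 0 := by
  obtain ⟨lbar, hlbar, H⟩ := Crisscross.exists_supSecondMoment_le P hr huv hc
  refine ⟨lbar, hlbar, fun l₀ hl₀ g₀ _ h γ _ hγ _ _ Ω' _ P' _ ℱ X _ T hT i => ?_⟩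
  obtain ⟨C, hC, hbound⟩ := H l₀ hl₀
  have htail : ∀ t₀, 0 ≤ t₀ → limsup (fun n : ℕ => Crisscross.discountedTail P γ
      (fun t ω => Crisscross.scaledWorkload (r n) n (fun k i => u k i ω)
        (fun j i => v j i ω) (T n ω) t i) t₀) atTop ≤ Crisscross.quarticTail C γ t₀ := by
    intro t₀ ht₀
    refine limsup_le_of_le (h := ?_)
    filter_upwards [hbound g₀ _ T hT] with n hn
    exact Crisscross.discountedTail_le ht₀ (hn i)
  refine ⟨(htail 0 le_rfl).trans_lt (Crisscross.quarticTail_zero_lt_top hC hγ), ?_⟩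
  refine Tendsto.limsup_eq (tendsto_of_tendsto_of_tendsto_of_le_of_le' tendsto_const_nhds
    (Crisscross.tendsto_quarticTail hC hγ) (Eventually.of_forall fun _ => zero_le) ?_)
  filter_upwards [eventually_ge_atTop 0] with t₀ ht₀
  exact htail t₀ ht₀
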